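/- Throughout, $\kappa\colon[0,\infty)\to(0,\infty)$ is monotone increasing, concave and sublinear ($\kappa(t)/t\to 0$ as $t\to\infty$). A *quasi-isometric embedding* $f$ satisfies $\frac1K d(x,y)-C\le d(f(x),f(y))\le Kd(x,y)+C$ for some $K\ge1$, $C\ge0$; it is a *quasi-isometry* if moreover every point of the target is within distance $C$ of its image, and *coarsely Lipschitz* maps satisfy the upper bound. A $(K,C)$-*quasi-geodesic* is a $(K,C)$-quasi-isometric embedding of an interval, and a *quasi-geodesic ray* one of some $[a,\infty)$ (continuity is not required). A map $f$ between spaces with $G$-actions is *coarsely $G$-equivariant* if $d(f(gy),gf(y))$ is bounded uniformly in $g,y$. *Hyperbolic projections.* A metric space $X$ is hyperbolic if, for some $\delta\ge0$, $(x\mid y)_o\ge\min\{(x\mid z)_o,(z\mid y)_o\}-\delta$ for all $x,y,z,o$, where $(x\mid y)_o=\frac12(d(o,x)+d(o,y)-d(x,y))$. It admits a quasi-ruling if for some $D\ge0$ any two points are the endpoints of a (not necessarily continuous) path $\gamma\colon[a,b]\to X$ with $d(\gamma(t),\gamma(s))+d(\gamma(s),\gamma(r))\le d(\gamma(t),\gamma(r))+D$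 for $t<s<r$ and $\limsup_{t\to t_0}d(\gamma(t),\gamma(t_0))<D$ for all $t_0$. A hyperbolic projection $(G,Y,X)$ consists of a finitely generated group $G$, a geometric (isometric, proper, cocompact) action of $G$ on a geodesic metric space $Y$, and a cobounded isometric action of $G$ on a hyperbolic space $X$ that admits a quasi-ruling. An *induced projection map* is a coarsely Lipschitz, coarsely $G$-equivariant map $p\colon Y\to X$; it is unique up to bounded distance. For two actions of $G$ on $X,X'$ write $X\sim X'$ if there is a coarsely $G$-equivariant quasi-isometry $X\to X'$. *Boundaries.* $\partial_\infty X$ is the set of sequences in $X$ with $(x_i\mid x_j)_o\to\infty$ as $i,j\to\infty$, modulo $(x_i)\sim(y_i)$ iff $(x_i\mid y_i)_o\to\infty$. The visual topology has the sets $\{\eta\mid(\xi\mid\eta)_o>R\}$, $R\ge0$, as a neighbourhood basis at $\xi$, where $(\xi\mid\eta)_o=\inf\liminf_i(x_i\mid y_i)_o$ over all $(x_i)\in\xi$, $(y_i)\in\eta$. A map $\gamma\colon[a,\infty)\to X$ defines the point $\xi\in\partial_\infty X$ if $(\gamma(t_i))_i$ converges to infinity and represents $\xi$ for every sequence $a\le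 t_1\le t_2\le\cdots\to\infty$. Fix base points $o$ in $Y$ and $Y'$ and let $\mathcal N_\kappa(Z,n)=\{y\mid d(y,Z)\le n\,\kappa(d(o,y))\}$. A subset $Z$ is $\kappa$-Morse if there is $\mu_Z\colon\mathbb R_+^2\to\mathbb R_+$ such that every $(K,C)$-quasi-geodesic $[s,t]\to Y$ with endpoints on $Z$ has image in $\mathcal N_\kappa(Z,\mu_Z(K,C))$; a quasi-geodesic ray is $\kappa$-Morse if its image is. Two rays $\kappa$-fellow travel if each is contained in $\mathcal N_\kappa(\cdot,n)$ of the other for some $n$. $\partial_\kappa Y$ is the set of $\kappa$-Morse quasi-geodesic rays modulo $\kappa$-fellow travelling. $(G,Y,X)$ is *$\kappa$-injective* if, for an induced projection map $p$, the composition $p\circ\gamma$ defines a point of $\partial_\infty X$ for every $\kappa$-Morse quasi-geodesic ray $\gamma$ in $Y$, and two such rays $\kappa$-fellow travel if and only if their compositions with $p$ define the same point. **Lemma B.** Let $(G,Y,X)$ and $(G,Y',X')$ be hyperbolic projections with $X\sim X'$. 1. $(G,Y,X)$ is $\kappa$-injective if and only if $(G,Y',X')$ is. 2. Let $\Psi\colon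 Y\to Y'$ and $\Phi\colon X\to X'$ be coarsely $G$-equivariant quasi-isometries, and let $p\colon Y\to X$ and $p'\colon Y'\to X'$ be induced projection maps. Then $[\gamma]\mapsto[\Psi\circ\gamma]$ and $[(x_i)]\mapsto[(\Phi(x_i))]$ are well-defined maps $\partial\Psi\colon\partial_\kappa Y\to\partial_\kappa Y'$ and $\partial\Phi\colon\partial_\infty X\to\partial_\infty X'$. If $(G,Y,X)$ is $\kappa$-injective, then $[\gamma]\mapsto[p\circ\gamma]$ and $[\gamma']\mapsto[p'\circ\gamma']$ are well-defined injective maps $\partial p\colon\partial_\kappa Y\to\partial_\infty X$ and $\partial p'\colon\partial_\kappa Y'\to\partial_\infty X'$, one has $\partial p'\circ\partial\Psi=\partial\Phi\circ\partial p$, and $$\partial\Psi\colon(\partial_\kappa Y,\mathcal T(G,Y,X))\to(\partial_\kappa Y',\mathcal T(G,Y',X'))$$ is a homeomorphism, where $\mathcal T(G,Y,X)$ and $\mathcal T(G,Y',X')$ are the pull-backs of the visual topologies under $\partial p$ and $\partial p'$. -/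

import Mathlib

open Filter Topology

/-! ### Coarse maps between metric spaces -/

/-- Coarsely Lipschitz maps: `d (f x) (f y) ≤ K d(x, y) + C`. -/
def IsCoarselyLipschitz {X X' : Type*} [MetricSpace X] [MetricSpace X'] (f : X → X') : Prop :=
  ∃ K C : ℝ, 1 ≤ K ∧ 0 ≤ C ∧ ∀ x y : X, dist (f x) (f y) ≤ K * dist x y + C

/-- Quasi-isometries: coarsely surjective `(K, C)`-quasi-isometric embeddings. -/
def IsQuasiIsometry {X X' : Type*} [MetricSpace X] [MetricSpace X'] (f : X → X') : Prop :=
  ∃ K C : ℝ, 1 ≤ K ∧ 0 ≤ C ∧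
    (∀ x y : X, 1 / K * dist x y - C ≤ dist (f x) (f y) ∧
      dist (f x) (f y) ≤ K * dist x y + C) ∧
    ∀ x' : X', ∃ x : X, dist (f x) x' ≤ C

/-- Coarsely `G`-equivariant maps. -/
def IsCoarselyEquivariant (G : Type*) [Group G] {Y X : Type*} [MetricSpace Y] [MetricSpace X]
    [MulAction G Y] [MulAction G X] (f : Y → X) : Prop :=
  ∃ C : ℝ, ∀ (g : G) (y : Y), dist (f (g • y)) (g • f y) ≤ C

/-- `γ`, restricted to the set `I` of parameters (an interval), is a `(K, C)`-quasi-isometric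
embedding. Values of `γ` outside `I` play no role. -/
def IsQuasiGeodesicOn {Y : Type*} [MetricSpace Y] (K C : ℝ) (I : Set ℝ) (γ : ℝ → Y) : Prop :=
  ∀ s ∈ I, ∀ t ∈ I, 1 / K * |s - t| - C ≤ dist (γ s) (γ t) ∧
    dist (γ s) (γ t) ≤ K * |s - t| + C

/-- Any two points are joined by a geodesic. -/
def IsGeodesicSpace (Y : Type*) [MetricSpace Y] : Prop :=
  ∀ x y : Y, ∃ γ : ℝ → Y, γ 0 = x ∧ γ (dist x y) = y ∧
    ∀ s ∈ Set.Icc 0 (dist x y), ∀ t ∈ Set.Icc 0 (dist x y), dist (γ s) (γ t) = |s - t|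

/-! ### Gromov hyperbolic spaces and their boundary at infinity -/

/-- The Gromov product `(x | y)_o`. -/
noncomputable def gromovProd {X : Type*} [MetricSpace X] (o x y : X) : ℝ :=
  (dist o x + dist o y - dist x y) / 2

/-- Gromov hyperbolic metric spaces, defined through the Gromov product. -/
class IsGromovHyperbolic (X : Type*) [MetricSpace X] : Prop where
  exists_delta : ∃ δ : ℝ, 0 ≤ δ ∧ ∀ x y z o : X,
    min (gromovProd o x z) (gromovProd o z y) - δ ≤ gromovProd o x y

/-- The sequence `x` converges to infinity: `(x i | x j)_o → ∞` as `i, j → ∞`, for every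
base point `o` (equivalently, for one of them). -/
def ConvergesToInfinity {X : Type*} [MetricSpace X] (x : ℕ → X) : Prop :=
  ∀ o : X, Tendsto (fun ij : ℕ × ℕ => gromovProd o (x ij.1) (x ij.2)) atTop atTop

/-- Sequences converging to infinity. -/
def SeqToInfinity (X : Type*) [MetricSpace X] : Type _ :=
  {x : ℕ → X // ConvergesToInfinity x}

/-- Two sequences `x`, `y` that converge to infinity are equivalent if `(x i | y i)_o → ∞`. -/
instance seqToInfinitySetoid (X : Type*) [MetricSpace X] [IsGromovHyperbolic X] :
    Setoid (SeqToInfinity X) where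
  r x y := ∀ o : X, Tendsto (fun i : ℕ => gromovProd o (x.1 i) (y.1 i)) atTop atTop
  iseqv :=
    { refl := fun x o => (x.2 o).comp (tendsto_atTop_diagonal (α := ℕ))
      symm := fun {x y} h o => by
        refine (h o).congr fun i => ?_
        simp only [gromovProd, dist_comm (x.1 i) (y.1 i)]
        ring
      trans := fun {x y z} h₁ h₂ o => by
        obtain ⟨δ, -, hδ⟩ := IsGromovHyperbolic.exists_delta (X := X)
        rw [tendsto_atTop]
        intro b
        filter_upwards [(tendsto_atTop.1 (h₁ o)) (b + δ), (tendsto_atTop.1 (h₂ o)) (b + δ)]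
          with i h₁i h₂i
        have h := hδ (x.1 i) (z.1 i) (y.1 i) o
        have h' := le_min h₁i h₂i
        linarith }

/-- The boundary at infinity `∂_∞ X`, as a set. -/
def VisualBoundary (X : Type*) [MetricSpace X] [IsGromovHyperbolic X] : Type _ :=
  Quotient (seqToInfinitySetoid X)

/-- The point of `∂_∞ X` represented by a sequence converging to infinity. -/
def VisualBoundary.mk {X : Type*} [MetricSpace X] [IsGromovHyperbolic X] (x : SeqToInfinity X) :
    VisualBoundary X :=
  Quotient.mk (seqToInfinitySetoid X) x

/-- The Gromov product `(ξ | η)_o ∈ [0, ∞]` of boundary points: the infimum of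
`liminf (x i | y i)_o` over all representatives `x` of `ξ` and `y` of `η`. -/
noncomputable def boundaryGromovProd {X : Type*} [MetricSpace X] [IsGromovHyperbolic X]
    (o : X) (ξ η : VisualBoundary X) : EReal :=
  ⨅ (x : SeqToInfinity X) (_ : VisualBoundary.mk x = ξ)
    (y : SeqToInfinity X) (_ : VisualBoundary.mk y = η),
    liminf (fun i : ℕ => ((gromovProd o (x.1 i) (y.1 i) : ℝ) : EReal)) atTop

/-- The visual topology on `∂_∞ X` (with base point `o`): a set `U` is open if with every point `ξ`
it contains one of the sets `U_{o, R}(ξ) = {η | (ξ | η)_o > R}`, `R ≥ 0`. -/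
@[reducible] def visualTopology {X : Type*} [MetricSpace X] [IsGromovHyperbolic X] (o : X) :
    TopologicalSpace (VisualBoundary X) where
  IsOpen U := ∀ ξ ∈ U, ∃ R : ℝ, 0 ≤ R ∧ {η | (R : EReal) < boundaryGromovProd o ξ η} ⊆ U
  isOpen_univ := fun _ _ => ⟨0, le_rfl, Set.subset_univ _⟩
  isOpen_inter := fun U V hU hV ξ hξ => by
    obtain ⟨R, hR, hRU⟩ := hU ξ hξ.1
    obtain ⟨S, _, hSV⟩ := hV ξ hξ.2
    refine ⟨max R S, le_max_of_le_left hR, fun η hη => ⟨hRU ?_, hSV ?_⟩⟩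
    · exact lt_of_le_of_lt (EReal.coe_le_coe_iff.2 (le_max_left R S)) hη
    · exact lt_of_le_of_lt (EReal.coe_le_coe_iff.2 (le_max_right R S)) hη
  isOpen_sUnion := fun 𝒰 h ξ ⟨U, hU, hξ⟩ => by
    obtain ⟨R, hR, hRU⟩ := h U hU ξ hξ
    exact ⟨R, hR, hRU.trans (Set.subset_sUnion_of_mem hU)⟩

/-- The map `γ : [a, ∞) → X` defines the point `ξ ∈ ∂_∞ X`: for every nondecreasing sequence of
parameters `t i ≥ a` tending to infinity, `γ (t i)` converges to infinity and represents `ξ`. -/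
def DefinesPoint {X : Type*} [MetricSpace X] [IsGromovHyperbolic X] (a : ℝ) (γ : ℝ → X)
    (ξ : VisualBoundary X) : Prop :=
  ∀ t : ℕ → ℝ, (∀ i, a ≤ t i) → Monotone t → Tendsto t atTop atTop →
    ∃ h : ConvergesToInfinity (fun i => γ (t i)), VisualBoundary.mk ⟨fun i => γ (t i), h⟩ = ξ

/-! ### Quasi-rulings -/

/-- The (not necessarily continuous) path `γ : [a, b] → X` is an unparametrised `D`-quasi-ruler. -/
def IsQuasiRuler {X : Type*} [MetricSpace X] (D a b : ℝ) (γ : ℝ → X) : Prop :=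
  (∀ t ∈ Set.Icc a b, ∀ s ∈ Set.Icc a b, ∀ r ∈ Set.Icc a b, t < s → s < r →
    dist (γ t) (γ s) + dist (γ s) (γ r) ≤ dist (γ t) (γ r) + D) ∧
  ∀ t₀ ∈ Set.Icc a b,
    limsup (fun t => edist (γ t) (γ t₀)) (𝓝[Set.Icc a b] t₀) < ENNReal.ofReal D

/-- For some `D ≥ 0`, any two points are joined by an unparametrised `D`-quasi-ruler. -/
def AdmitsQuasiRuling (X : Type*) [MetricSpace X] : Prop :=
  ∃ D : ℝ, 0 ≤ D ∧ ∀ x y : X, ∃ (a b : ℝ) (γ : ℝ → X),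
    a ≤ b ∧ γ a = x ∧ γ b = y ∧ IsQuasiRuler D a b γ

/-! ### Group actions -/

/-- Geometric actions: isometric, (metrically) proper and cocompact. -/
structure IsGeometricAction (G : Type*) [Group G] (Y : Type*) [MetricSpace Y] [MulAction G Y] :
    Prop where
  isometric : IsIsometricSMul G Y
  proper : ∀ (y : Y) (R : ℝ), {g : G | dist (g • y) y ≤ R}.Finite
  cocompact : ∃ K : Set Y, IsCompact K ∧ ∀ y : Y, ∃ (g : G) (k : Y), k ∈ K ∧ g • k = y

/-- Cobounded actions: the translates of some bounded set cover the space. -/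
def IsCoboundedAction (G : Type*) [Group G] (X : Type*) [MetricSpace X] [MulAction G X] : Prop :=
  ∃ B : Set X, Bornology.IsBounded B ∧ ∀ x : X, ∃ (g : G) (b : X), b ∈ B ∧ g • b = x

/-- `X ∼ X'`: there is a coarsely `G`-equivariant quasi-isometry `X → X'`. -/
def ActionEquivalent (G : Type*) [Group G] (X X' : Type*) [MetricSpace X] [MetricSpace X']
    [MulAction G X] [MulAction G X'] : Prop :=
  ∃ Φ : X → X', IsQuasiIsometry Φ ∧ IsCoarselyEquivariant G Φ

/-- Hyperbolic projections `(G, Y, X)`: a finitely generated group `G` acting geometrically on a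
geodesic metric space `Y` and coboundedly, by isometries, on a hyperbolic space `X` that admits a
quasi-ruling. -/
structure IsHyperbolicProjection (G : Type*) [Group G] (Y X : Type*) [MetricSpace Y]
    [MetricSpace X] [IsGromovHyperbolic X] [MulAction G Y] [MulAction G X] : Prop where
  fg : Group.FG G
  geodesic : IsGeodesicSpace Y
  geometric : IsGeometricAction G Y
  quasiRuling : AdmitsQuasiRuling X
  isometric : IsIsometricSMul G X
  cobounded : IsCoboundedAction G X

/-- Projection maps `Y → X` induced by the actions; they are unique up to bounded distance. -/
def IsInducedProjection (G : Type*) [Group G] {Y X : Type*} [MetricSpace Y] [MetricSpace X]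
    [MulAction G Y] [MulAction G X] (p : Y → X) : Prop :=
  IsCoarselyLipschitz p ∧ IsCoarselyEquivariant G p

/-! ### Sublinearly Morse boundaries -/

/-- Functions `κ : [0, ∞) → (0, ∞)` that are monotone increasing, concave and sublinear. Values at
negative arguments play no role. -/
structure SublinearFunction where
  toFun : ℝ → ℝ
  pos : ∀ t, 0 ≤ t → 0 < toFun t
  mono : MonotoneOn toFun (Set.Ici 0)
  concave : ConcaveOn ℝ (Set.Ici 0) toFun
  sublinear : Tendsto (fun t => toFun t / t) atTop (𝓝 0)

/-- The `(κ, n)`-neighbourhood of `Z` in the space `Y` with base point `o`. -/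
def kappaNeighborhood (κ : SublinearFunction) {Y : Type*} [MetricSpace Y] (o : Y) (Z : Set Y)
    (n : ℝ) : Set Y :=
  {y | Metric.infDist y Z ≤ n * κ.toFun (dist o y)}

/-- `κ`-Morse subsets of the space `Y` with base point `o`. -/
def IsKappaMorse (κ : SublinearFunction) {Y : Type*} [MetricSpace Y] (o : Y) (Z : Set Y) : Prop :=
  ∃ μ : ℝ → ℝ → ℝ, (∀ K C, 0 ≤ μ K C) ∧
    ∀ (K C : ℝ), 1 ≤ K → 0 ≤ C → ∀ (s t : ℝ) (β : ℝ → Y), s ≤ t →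
      IsQuasiGeodesicOn K C (Set.Icc s t) β → β s ∈ Z → β t ∈ Z →
      β '' Set.Icc s t ⊆ kappaNeighborhood κ o Z (μ K C)

/-- Quasi-geodesic rays `[start, ∞) → Y`; values of `toFun` before `start` play no role. -/
structure QuasiGeodesicRay (Y : Type*) [MetricSpace Y] where
  start : ℝ
  toFun : ℝ → Y
  quasiGeodesic : ∃ K C : ℝ, 1 ≤ K ∧ 0 ≤ C ∧ IsQuasiGeodesicOn K C (Set.Ici start) toFun

/-- The image of a quasi-geodesic ray. -/
def QuasiGeodesicRay.image {Y : Type*} [MetricSpace Y] (γ : QuasiGeodesicRay Y) : Set Y :=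
  γ.toFun '' Set.Ici γ.start

/-- `α` and `β` `κ`-fellow travel each other. -/
def KappaFellowTravel (κ : SublinearFunction) {Y : Type*} [MetricSpace Y] (o : Y)
    (α β : QuasiGeodesicRay Y) : Prop :=
  (∃ n : ℝ, α.image ⊆ kappaNeighborhood κ o β.image n) ∧
  ∃ n : ℝ, β.image ⊆ kappaNeighborhood κ o α.image n

theorem QuasiGeodesicRay.image_nonempty {Y : Type*} [MetricSpace Y] (γ : QuasiGeodesicRay Y) :
    γ.image.Nonempty :=
  ⟨γ.toFun γ.start, γ.start, Set.mem_Ici.2 le_rfl, rfl⟩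

theorem SublinearFunction.mul_le (κ : SublinearFunction) {a b : ℝ} (ha : 0 ≤ a) (hab : a ≤ b)
    (hb : 0 < b) : a / b * κ.toFun b ≤ κ.toFun a := by
  have h1 : 0 ≤ a / b := by positivity
  have h2 : 0 ≤ 1 - a / b := by rw [sub_nonneg]; exact (div_le_one hb).2 hab
  have h := κ.concave.2 (Set.mem_Ici.2 hb.le) (Set.mem_Ici.2 (le_refl (0 : ℝ))) h1 h2 (by ring)
  simp only [smul_eq_mul, mul_zero, add_zero, div_mul_cancel₀ a hb.ne'] at h
  have h0 : 0 ≤ (1 - a / b) * κ.toFun 0 :=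
    mul_nonneg h2 (κ.pos 0 le_rfl).le
  linarith

theorem SublinearFunction.add_le (κ : SublinearFunction) {a b : ℝ} (ha : 0 ≤ a) (hb : 0 ≤ b) :
    κ.toFun (a + b) ≤ κ.toFun a + κ.toFun b := by
  rcases (add_nonneg ha hb).eq_or_lt with h | h
  · have ha0 : a = 0 := by linarith
    have hb0 : b = 0 := by linarith
    subst ha0; subst hb0
    have := κ.pos 0 le_rfl
    simp only [add_zero]
    linarith
  · have h1 := κ.mul_le ha (by linarith) h
    have h2 := κ.mul_le hb (by linarith) h
    have h3 : a / (a + b) * κ.toFun (a + b) + b / (a + b) * κ.toFun (a + b)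
        = κ.toFun (a + b) := by
      field_simp
    linarith

theorem SublinearFunction.le_linear (κ : SublinearFunction) {t : ℝ} (ht : 0 ≤ t) :
    κ.toFun t ≤ κ.toFun 1 * (1 + t) := by
  have h1 := κ.pos 1 zero_le_one
  rcases le_total t 1 with h | h
  · have := κ.mono (Set.mem_Ici.2 ht) (Set.mem_Ici.2 zero_le_one) h
    nlinarith
  · have ht0 : 0 < t := by linarith
    have h2 := κ.mul_le zero_le_one h ht0
    rw [one_div, inv_mul_le_iff₀ ht0] at h2
    nlinarith

theorem kappaNeighborhood_trans (κ : SublinearFunction) {Y : Type*} [MetricSpace Y] (o : Y)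
    {A B Z : Set Y} (hB : B.Nonempty) {n m : ℝ} (hAB : A ⊆ kappaNeighborhood κ o B n)
    (hBZ : B ⊆ kappaNeighborhood κ o Z m) : ∃ k : ℝ, A ⊆ kappaNeighborhood κ o Z k := by
  have hk0 := κ.pos 0 le_rfl
  have hk1 := κ.pos 1 zero_le_one
  refine ⟨n + 1 / κ.toFun 0 + |m| * (1 + κ.toFun 1 * (2 / κ.toFun 0 + n)), fun x hx => ?_⟩
  have h1 : Metric.infDist x B ≤ n * κ.toFun (dist o x) := hAB hx
  obtain ⟨y, hy, hxy⟩ := (Metric.infDist_lt_iff hB (r := n * κ.toFun (dist o x) + 1)).1 (by linarith)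
  have h2 : Metric.infDist y Z ≤ m * κ.toFun (dist o y) := hBZ hy
  have h3 : Metric.infDist x Z ≤ Metric.infDist y Z + dist x y := Metric.infDist_le_infDist_add_dist
  have hn : 0 ≤ n * κ.toFun (dist o x) := Metric.infDist_nonneg.trans h1
  have hx0 : κ.toFun 0 ≤ κ.toFun (dist o x) :=
    κ.mono (Set.mem_Ici.2 le_rfl) (Set.mem_Ici.2 dist_nonneg) dist_nonneg
  have hone : 1 ≤ 1 / κ.toFun 0 * κ.toFun (dist o x) := by
    rw [one_div, inv_mul_eq_div]; exact (one_le_div hk0).2 hx0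
  have hu : 0 ≤ n * κ.toFun (dist o x) + 1 := by linarith
  have h4 : κ.toFun (dist o y) ≤ κ.toFun (dist o x + (n * κ.toFun (dist o x) + 1)) :=
    κ.mono (Set.mem_Ici.2 dist_nonneg) (Set.mem_Ici.2 (add_nonneg dist_nonneg hu))
      ((dist_triangle o x y).trans (by linarith))
  have h5 := κ.add_le (a := dist o x) dist_nonneg hu
  have h6 := κ.le_linear hu
  have h7 : κ.toFun (dist o y) ≤
      (1 + κ.toFun 1 * (2 / κ.toFun 0 + n)) * κ.toFun (dist o x) := by
    have h8 : κ.toFun 1 * (1 + (n * κ.toFun (dist o x) + 1)) ≤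
        κ.toFun 1 * ((2 / κ.toFun 0 + n) * κ.toFun (dist o x)) := by
      apply mul_le_mul_of_nonneg_left _ hk1.le
      have : 2 / κ.toFun 0 = 2 * (1 / κ.toFun 0) := by ring
      rw [this]; nlinarith
    nlinarith
  have h9 : m * κ.toFun (dist o y) ≤
      |m| * ((1 + κ.toFun 1 * (2 / κ.toFun 0 + n)) * κ.toFun (dist o x)) :=
    (mul_le_mul_of_nonneg_right (le_abs_self m) (κ.pos _ dist_nonneg).le).trans
      (mul_le_mul_of_nonneg_left h7 (abs_nonneg m))
  change Metric.infDist x Z ≤ _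
  nlinarith

/-- `κ`-Morse quasi-geodesic rays of the space `Y` with base point `o`. -/
def KappaMorseRay (κ : SublinearFunction) {Y : Type*} [MetricSpace Y] (o : Y) : Type _ :=
  {γ : QuasiGeodesicRay Y // IsKappaMorse κ o γ.image}

/-- `κ`-fellow travelling is an equivalence relation on `κ`-Morse quasi-geodesic rays. -/
instance kappaMorseRaySetoid (κ : SublinearFunction) {Y : Type*} [MetricSpace Y] (o : Y) :
    Setoid (KappaMorseRay κ o) where
  r α β := KappaFellowTravel κ o α.1 β.1
  iseqv :=
    { refl := fun α => by
        have h : α.1.image ⊆ kappaNeighborhood κ o α.1.image 0 := fun x hx => by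
          change Metric.infDist x _ ≤ _
          rw [Metric.infDist_zero_of_mem hx, zero_mul]
        exact ⟨⟨0, h⟩, ⟨0, h⟩⟩
      symm := fun h => ⟨h.2, h.1⟩
      trans := fun {α β γ} h₁ h₂ => by
        obtain ⟨⟨n, hn⟩, ⟨n', hn'⟩⟩ := h₁
        obtain ⟨⟨m, hm⟩, ⟨m', hm'⟩⟩ := h₂
        exact ⟨kappaNeighborhood_trans κ o β.1.image_nonempty hn hm,
          kappaNeighborhood_trans κ o β.1.image_nonempty hm' hn'⟩ }

/-- The `κ`-Morse boundary `∂_κ Y` of the space `Y` with base point `o`. -/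
def KappaBoundary (κ : SublinearFunction) {Y : Type*} [MetricSpace Y] (o : Y) : Type _ :=
  Quotient (kappaMorseRaySetoid κ o)

/-- The point of `∂_κ Y` represented by a `κ`-Morse quasi-geodesic ray. -/
def KappaBoundary.mk {κ : SublinearFunction} {Y : Type*} [MetricSpace Y] {o : Y}
    (γ : KappaMorseRay κ o) : KappaBoundary κ o :=
  Quotient.mk (kappaMorseRaySetoid κ o) γ

/-! ### `κ`-injectivity and boundary maps -/

/-- `(G, Y, X)` is `κ`-injective, where `o` is the base point of `Y`: for an induced projection map
`p`, the projection of every `κ`-Morse quasi-geodesic ray defines a point in `∂_∞ X`, and two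
`κ`-Morse quasi-geodesic rays `κ`-fellow travel if and only if their projections define the same
point. -/
def IsKappaInjective (G : Type*) [Group G] (κ : SublinearFunction) {Y : Type*} (o : Y) (X : Type*)
    [MetricSpace Y] [MetricSpace X] [IsGromovHyperbolic X] [MulAction G Y] [MulAction G X] :
    Prop :=
  ∃ p : Y → X, IsInducedProjection G p ∧
    (∀ γ : KappaMorseRay κ o, ∃ ξ : VisualBoundary X,
      DefinesPoint γ.1.start (fun t => p (γ.1.toFun t)) ξ) ∧
    ∀ γ₁ γ₂ : KappaMorseRay κ o, KappaFellowTravel κ o γ₁.1 γ₂.1 ↔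
      ∃ ξ : VisualBoundary X, DefinesPoint γ₁.1.start (fun t => p (γ₁.1.toFun t)) ξ ∧
        DefinesPoint γ₂.1.start (fun t => p (γ₂.1.toFun t)) ξ

/-- `dp` is the map `∂p : ∂_κ Y → ∂_∞ X`, `[γ] ↦ [p ∘ γ]`. -/
def IsProjectionBoundaryMap {κ : SublinearFunction} {Y X : Type*} [MetricSpace Y] [MetricSpace X]
    [IsGromovHyperbolic X] {o : Y} (p : Y → X) (dp : KappaBoundary κ o → VisualBoundary X) :
    Prop :=
  ∀ γ : KappaMorseRay κ o,
    DefinesPoint γ.1.start (fun t => p (γ.1.toFun t)) (dp (KappaBoundary.mk γ))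

/-- `dΨ` is the map `∂Ψ : ∂_κ Y → ∂_κ Y'`, `[γ] ↦ [Ψ ∘ γ]`; in particular `Ψ ∘ γ` is a `κ`-Morse
quasi-geodesic ray for every `κ`-Morse quasi-geodesic ray `γ`. -/
def IsKappaBoundaryMap {κ : SublinearFunction} {Y Y' : Type*} [MetricSpace Y] [MetricSpace Y']
    {o : Y} {o' : Y'} (Ψ : Y → Y') (dΨ : KappaBoundary κ o → KappaBoundary κ o') : Prop :=
  ∀ γ : KappaMorseRay κ o, ∃ γ' : KappaMorseRay κ o',
    γ'.1.start = γ.1.start ∧ (∀ t, γ'.1.toFun t = Ψ (γ.1.toFun t)) ∧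
      dΨ (KappaBoundary.mk γ) = KappaBoundary.mk γ'

/-- `dΦ` is the map `∂Φ : ∂_∞ X → ∂_∞ X'`, `[(x i)] ↦ [(Φ (x i))]`; in particular `Φ` maps sequences
converging to infinity to sequences converging to infinity. -/
def IsVisualBoundaryMap {X X' : Type*} [MetricSpace X] [MetricSpace X'] [IsGromovHyperbolic X]
    [IsGromovHyperbolic X'] (Φ : X → X') (dΦ : VisualBoundary X → VisualBoundary X') : Prop :=
  ∀ x : SeqToInfinity X, ∃ x' : SeqToInfinity X',
    (∀ i, x'.1 i = Φ (x.1 i)) ∧ dΦ (VisualBoundary.mk x) = VisualBoundary.mk x'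

/-- The topology `𝒯(G, Y, X)` on `∂_κ Y`: the pull-back under `dp = ∂p` of the visual topology on
`∂_∞ X` (with base point `x₀`). -/
@[reducible] def projectionTopology {κ : SublinearFunction} {Y X : Type*} [MetricSpace Y] [MetricSpace X]
    [IsGromovHyperbolic X] {o : Y} (x₀ : X) (dp : KappaBoundary κ o → VisualBoundary X) :
    TopologicalSpace (KappaBoundary κ o) :=
  TopologicalSpace.induced dp (visualTopology x₀)

/-! ### Gromov products -/

section GromovProduct

variable {X : Type*} [MetricSpace X]

/-! Everything at infinity rests on one estimate: a quasi-isometry from a space that admits a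
quasi-ruling to a hyperbolic space decreases Gromov products at most linearly
(`IsQuasiIsometry.preservesGromovProd`). Since X need not be geodesic, the usual stability of
quasi-geodesics is replaced by a direct argument. On a ruler from x to y take a point γ m whose
image is almost closest to Φ o. Away from γ m the distance of the image to Φ o grows at a linear
rate, and along a chain of long steps this growth pays for the δ lost at each use of hyperbolicity,
so errors do not accumulate (`exists_sub_le_gromovProd`). Hence Φ acts continuously on ∂_∞ X, and a
quasi-inverse gives the continuous inverse.

In Y, concavity and positivity of κ show that a quasi-isometry and a change of base point distort
κ(d(o, ·)) by at most a bounded factor. So κ-neighbourhoods, κ-Morse sets and fellow travelling are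
transported, and a quasi-inverse makes ∂Ψ a bijection.

The two sides are tied together by the uniqueness of induced projections: Φ ∘ p and p' ∘ Ψ are both
coarsely Lipschitz and coarsely equivariant, hence at bounded distance, hence define the same
boundary points. This is the commuting square, and the pull-back topologies then correspond. For
part 1 no map between Y and Y' is given; a Milnor–Švarc argument supplies Θ : Y' → Y, and Φ ∘ p ∘ Θ
is an induced projection that inherits κ-injectivity. -/

theorem gromovProd_comm (o x y : X) : gromovProd o x y = gromovProd o y x := by
  simp only [gromovProd, dist_comm x y]; ring

theorem gromovProd_le_add_dist (o x y x' y' : X) :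
    gromovProd o x y ≤ gromovProd o x' y' + dist x x' + dist y y' := by
  simp only [gromovProd]
  have h1 := dist_triangle o x' x
  have h2 := dist_triangle o y' y
  have h3 := dist_triangle4 x' x y y'
  rw [dist_comm x' x] at h1 h3
  rw [dist_comm y' y] at h2
  linarith

theorem gromovProd_le_add_dist_base (o o' x y : X) :
    gromovProd o x y ≤ gromovProd o' x y + dist o o' := by
  simp only [gromovProd]
  have h1 := dist_triangle o o' x
  have h2 := dist_triangle o o' y
  linarith

theorem dist_sub_dist_le_gromovProd (o x y : X) : dist o x - dist x y ≤ gromovProd o x y := by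
  simp only [gromovProd]
  have h1 := dist_triangle o y x
  rw [dist_comm y x] at h1
  linarith

end GromovProduct

/-! ### Coarse rulers -/

/-- A path that satisfies the reverse triangle inequality up to `D` and whose jumps are bounded
by `D`. -/
structure IsCoarseRuler {X : Type*} [MetricSpace X] (D a b : ℝ) (γ : ℝ → X) : Prop where
  add_le : ∀ t s r, a ≤ t → t ≤ s → s ≤ r → r ≤ b →
    dist (γ t) (γ s) + dist (γ s) (γ r) ≤ dist (γ t) (γ r) + D
  jump : ∀ t₀ ∈ Set.Icc a b, ∃ ε > 0, ∀ t ∈ Set.Icc a b, |t - t₀| < ε → dist (γ t) (γ t₀) ≤ D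

theorem IsQuasiRuler.isCoarseRuler {X : Type*} [MetricSpace X] {D a b : ℝ} {γ : ℝ → X}
    (hD : 0 ≤ D) (h : IsQuasiRuler D a b γ) : IsCoarseRuler D a b γ where
  add_le t s r hat hts hsr hrb := by
    rcases hts.eq_or_lt with rfl | hts
    · simpa using hD
    rcases hsr.eq_or_lt with rfl | hsr
    · simpa using hD
    exact h.1 t ⟨hat, by linarith⟩ s ⟨by linarith, by linarith⟩ r ⟨by linarith, hrb⟩ hts hsr
  jump t₀ ht₀ := by
    have h1 := eventually_lt_of_limsup_lt (h.2 t₀ ht₀)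
    obtain ⟨ε, hε, hs⟩ := Metric.mem_nhdsWithin_iff.1 h1
    refine ⟨ε, hε, fun t ht htt => ?_⟩
    have h2 : edist (γ t) (γ t₀) < ENNReal.ofReal D :=
      hs ⟨by rwa [Metric.mem_ball, Real.dist_eq], ht⟩
    rw [edist_dist] at h2
    exact (ENNReal.ofReal_lt_ofReal_iff_of_nonneg dist_nonneg).1 h2 |>.le

theorem IsCoarseRuler.reverse {X : Type*} [MetricSpace X] {D a b : ℝ} {γ : ℝ → X}
    (h : IsCoarseRuler D a b γ) : IsCoarseRuler D (-b) (-a) (fun t => γ (-t)) where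
  add_le t s r hat hts hsr hrb := by
    have := h.add_le (-r) (-s) (-t) (by linarith) (by linarith) (by linarith) (by linarith)
    rw [dist_comm (γ (-t)) (γ (-s)), dist_comm (γ (-s)) (γ (-r)), dist_comm (γ (-t)) (γ (-r))]
    linarith
  jump t₀ ht₀ := by
    obtain ⟨ε, hε, hs⟩ := h.jump (-t₀) ⟨by linarith [ht₀.2], by linarith [ht₀.1]⟩
    refine ⟨ε, hε, fun t ht htt => hs (-t) ⟨by linarith [ht.2], by linarith [ht.1]⟩ ?_⟩
    rwa [← abs_neg, show -(-t - -t₀) = t - t₀ by ring]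

/-- Discrete substitute for the intermediate value theorem. The first parameter at which γ has moved
by N is an infimum, and the path can overshoot N there only by the two jumps on either side of it,
whence 2D. -/
theorem IsCoarseRuler.exists_step {X : Type*} [MetricSpace X] {D a b : ℝ} {γ : ℝ → X}
    (hD : 0 ≤ D) (h : IsCoarseRuler D a b γ) {N s : ℝ} (hN : 0 < N) (hs : s ∈ Set.Icc a b) :
    ∃ t ∈ Set.Icc s b, dist (γ s) (γ t) ≤ N + 2 * D ∧ (t = b ∨ N ≤ dist (γ s) (γ t)) := by
  set S : Set ℝ := {t | t ∈ Set.Icc s b ∧ N ≤ dist (γ s) (γ t)} with hS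
  rcases S.eq_empty_or_nonempty with h0 | h0
  · refine ⟨b, ⟨hs.2, le_rfl⟩, ?_, Or.inl rfl⟩
    by_contra hb
    have : b ∈ S := ⟨⟨hs.2, le_rfl⟩, by linarith⟩
    rw [h0] at this
    exact this
  have hbdd : BddBelow S := ⟨s, fun t ht => ht.1.1⟩
  have hsS : s ≤ sInf S := le_csInf h0 fun t ht => ht.1.1
  have hSb : sInf S ≤ b := by
    obtain ⟨t, ht⟩ := h0
    exact (csInf_le hbdd ht).trans ht.1.2
  obtain ⟨ε, hε, hj⟩ := h.jump (sInf S) ⟨hs.1.trans hsS, hSb⟩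
  obtain ⟨t, ht, htS⟩ := exists_lt_of_csInf_lt h0 (show sInf S < sInf S + ε by linarith)
  have htl : sInf S ≤ t := csInf_le hbdd ht
  refine ⟨t, ht.1, ?_, Or.inr ht.2⟩
  have h1 : dist (γ t) (γ (sInf S)) ≤ D := hj t ⟨hs.1.trans ht.1.1, ht.1.2⟩
    (by rw [abs_lt]; constructor <;> linarith)
  -- A parameter just before the infimum, truncated at s; the path has not yet left the N-ball
  -- around γ s there.
  set u := max s (sInf S - ε / 2) with hu
  have hus : s ≤ u := le_max_left _ _
  have hu2 : sInf S - ε / 2 ≤ u := le_max_right _ _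
  have huS : u ≤ sInf S := max_le hsS (by linarith)
  have h2 : dist (γ u) (γ (sInf S)) ≤ D := hj u ⟨hs.1.trans hus, huS.trans hSb⟩
    (by rw [abs_lt]; constructor <;> linarith)
  have h3 : dist (γ s) (γ u) ≤ N := by
    rcases max_choice s (sInf S - ε / 2) with hc | hc
    · rw [hu, hc, dist_self]; exact hN.le
    · by_contra hcon
      have : sInf S ≤ u := csInf_le hbdd ⟨⟨hus, huS.trans hSb⟩, by linarith⟩
      rw [hu, hc] at this
      linarith
  have h4 := dist_triangle4 (γ s) (γ u) (γ (sInf S)) (γ t)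
  rw [dist_comm (γ (sInf S)) (γ t)] at h4
  linarith

/-- If the image of a coarse ruler moves away from `o'` at a linear rate, the Gromov product of its
endpoints is bounded below. -/
theorem exists_sub_le_gromovProd {X X' : Type*} [MetricSpace X] [MetricSpace X']
    [IsGromovHyperbolic X'] {Φ : X → X'} {K C D ε : ℝ} (hK : 1 ≤ K) (hD : 0 ≤ D)
    (hε : 0 < ε) (hΦ : ∀ x y, dist (Φ x) (Φ y) ≤ K * dist x y + C) :
    ∃ E : ℝ, ∀ (a b : ℝ) (γ : ℝ → X), IsCoarseRuler D a b γ → ∀ m ∈ Set.Icc a b,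
      ∀ (o' : X') (A : ℝ),
        (∀ s ∈ Set.Icc m b, A + ε * dist (γ m) (γ s) ≤ dist o' (Φ (γ s))) →
        A - E ≤ gromovProd o' (Φ (γ m)) (Φ (γ b)) := by
  obtain ⟨δ, hδ0, hδ⟩ := IsGromovHyperbolic.exists_delta (X := X')
  -- The step length is chosen so that ε (N - D) ≥ δ, which compensates one hyperbolicity error, and
  -- N - D ≥ 1, which makes the induction on the remaining distance terminate.
  set N := D + δ / ε + 1 with hN
  have hδε : 0 ≤ δ / ε := by positivity
  have hN0 : 0 < N := by linarith
  have hNδ : δ ≤ ε * (N - D) := by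
    have : ε * (δ / ε) = δ := by field_simp
    have : ε * (N - D) = δ + ε := by rw [hN]; linear_combination this
    linarith
  refine ⟨K * (N + 2 * D) + C + δ, fun a b γ hγ m hm o' A hA => ?_⟩
  -- The term ε d(γ m, γ s) strengthens the claim so that it is inductive: a step from s to t raises
  -- it by at least ε (N - D) ≥ δ, exactly what the δ-inequality through Φ (γ t) consumes.
  have key : ∀ n : ℕ, ∀ s ∈ Set.Icc m b, dist (γ s) (γ b) ≤ n →
      A + ε * dist (γ m) (γ s) - (K * (N + 2 * D) + C + δ) ≤
        gromovProd o' (Φ (γ s)) (Φ (γ b)) := by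
    intro n
    induction n with
    | zero =>
      intro s hs hn
      have h1 := hA s hs
      have h2 := dist_sub_dist_le_gromovProd o' (Φ (γ s)) (Φ (γ b))
      have h3 := hΦ (γ s) (γ b)
      have h4 : K * dist (γ s) (γ b) ≤ K * (N + 2 * D) :=
        mul_le_mul_of_nonneg_left (by push_cast at hn; linarith) (by linarith)
      linarith
    | succ n ih =>
      intro s hs hn
      push_cast at hn
      obtain ⟨t, ht, hst, h0⟩ := hγ.exists_step hD hN0 (s := s) ⟨hm.1.trans hs.1, hs.2⟩
      have h1 := hA s hs
      have h2 := dist_sub_dist_le_gromovProd o' (Φ (γ s)) (Φ (γ t))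
      have h3 := hΦ (γ s) (γ t)
      have h4 : K * dist (γ s) (γ t) ≤ K * (N + 2 * D) :=
        mul_le_mul_of_nonneg_left hst (by linarith)
      rcases h0 with rfl | h0
      · linarith
      have h5 := hγ.add_le s t b (hm.1.trans hs.1) ht.1 ht.2 le_rfl
      have h6 := hγ.add_le m s t hm.1 hs.1 ht.1 ht.2
      have h7 := ih t ⟨hs.1.trans ht.1, ht.2⟩ (by linarith)
      have h8 := hδ (Φ (γ s)) (Φ (γ b)) (Φ (γ t)) o'
      have h9 : ε * (dist (γ m) (γ s) + (N - D)) ≤ ε * dist (γ m) (γ t) :=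
        mul_le_mul_of_nonneg_left (by linarith) hε.le
      have h10 : A + ε * dist (γ m) (γ s) - (K * (N + 2 * D) + C + δ) + δ ≤
          min (gromovProd o' (Φ (γ s)) (Φ (γ t))) (gromovProd o' (Φ (γ t)) (Φ (γ b))) :=
        le_min (by linarith) (by linarith)
      linarith
  obtain ⟨n, hn⟩ := exists_nat_ge (dist (γ m) (γ b))
  have := key n m ⟨le_rfl, hm.2⟩ hn
  rw [dist_self, mul_zero, add_zero] at this
  exact this

/-- `Φ` decreases Gromov products at most linearly. -/
def PreservesGromovProd {X X' : Type*} [MetricSpace X] [MetricSpace X'] (Φ : X → X') : Prop :=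
  ∃ c > 0, ∃ E : ℝ, ∀ o x y : X, c * gromovProd o x y - E ≤ gromovProd (Φ o) (Φ x) (Φ y)

theorem IsQuasiIsometry.preservesGromovProd {X X' : Type*} [MetricSpace X] [MetricSpace X']
    [IsGromovHyperbolic X'] (hX : AdmitsQuasiRuling X) {Φ : X → X'} (hΦ : IsQuasiIsometry Φ) :
    PreservesGromovProd Φ := by
  obtain ⟨δ, hδ0, hδ⟩ := IsGromovHyperbolic.exists_delta (X := X')
  obtain ⟨D, hD, hrule⟩ := hX
  obtain ⟨K, C, hK, hC, hKC, -⟩ := hΦ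
  have hK0 : 0 < K := by linarith
  obtain ⟨E, hE⟩ := exists_sub_le_gromovProd (ε := 1 / (3 * K)) hK hD (by positivity)
    fun x y => (hKC x y).2
  refine ⟨1 / (3 * K), by positivity, 1 / (3 * K) * (D / 2) + 2 * C + 2 + E + δ, fun o x y => ?_⟩
  obtain ⟨a, b, γ, hab, rfl, rfl, hγ'⟩ := hrule x y
  have hγ := hγ'.isCoarseRuler hD
  -- The ruler need not be continuous, so the minimum may not be attained; closest up to 1 is
  -- enough.
  obtain ⟨m, hm, hmin⟩ : ∃ m ∈ Set.Icc a b, ∀ s ∈ Set.Icc a b,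
      dist (Φ o) (Φ (γ m)) ≤ dist (Φ o) (Φ (γ s)) + 1 := by
    set S := (fun s => dist (Φ o) (Φ (γ s))) '' Set.Icc a b with hS
    have hne : S.Nonempty := ⟨_, a, ⟨le_rfl, hab⟩, rfl⟩
    have hbdd : BddBelow S := ⟨0, by rintro _ ⟨s, -, rfl⟩; exact dist_nonneg⟩
    obtain ⟨_, ⟨m, hm, rfl⟩, hlt⟩ := exists_lt_of_csInf_lt hne (lt_add_one (sInf S))
    refine ⟨m, hm, fun s hs => ?_⟩
    have : sInf S ≤ _ := csInf_le hbdd ⟨s, hs, rfl⟩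
    simp only at hlt this
    linarith
  set R := dist (Φ o) (Φ (γ m)) with hR
  -- The distance is at least R - 1 by the choice of m, and at least d(γ m, γ s) / K - C - R by the
  -- triangle inequality. Weighting these with 2/3 and 1/3 leaves a positive multiple of both R and
  -- d(γ m, γ s).
  have hgrow : ∀ s ∈ Set.Icc a b,
      (R / 3 - C - 1) + 1 / (3 * K) * dist (γ m) (γ s) ≤ dist (Φ o) (Φ (γ s)) := by
    intro s hs
    have h1 := hmin s hs
    have h2 := (hKC (γ m) (γ s)).1
    have h3 := dist_triangle (Φ (γ m)) (Φ o) (Φ (γ s))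
    rw [dist_comm (Φ (γ m)) (Φ o)] at h3
    have h4 : 1 / (3 * K) * dist (γ m) (γ s) = (1 / K * dist (γ m) (γ s)) / 3 := by
      field_simp
    linarith
  have hright := hE a b γ hγ m hm (Φ o) _ fun s hs => hgrow s ⟨hm.1.trans hs.1, hs.2⟩
  have hleft := hE (-b) (-a) _ hγ.reverse (-m) ⟨by linarith [hm.2], by linarith [hm.1]⟩ (Φ o)
    (R / 3 - C - 1) (fun s hs => by
      simpa using hgrow (-s) ⟨by linarith [hs.2], by linarith [hs.1, hm.2]⟩)
  simp only [neg_neg] at hleft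
  rw [gromovProd_comm] at hleft
  have h1 := hδ (Φ (γ a)) (Φ (γ b)) (Φ (γ m)) (Φ o)
  have h2 := le_min hleft hright
  -- Any point of a ruler bounds the Gromov product of its endpoints from above, and d(o, γ m) is
  -- controlled by R since Φ is a quasi-isometric embedding.
  have h3 : gromovProd o (γ a) (γ b) ≤ dist o (γ m) + D / 2 := by
    have h4 := hγ.add_le a m b le_rfl hm.1 hm.2 le_rfl
    have h5 := dist_triangle o (γ m) (γ a)
    have h6 := dist_triangle o (γ m) (γ b)
    rw [dist_comm (γ m) (γ a)] at h5
    simp only [gromovProd]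
    linarith
  have h4 : 1 / (3 * K) * gromovProd o (γ a) (γ b) ≤ 1 / (3 * K) * (dist o (γ m) + D / 2) :=
    mul_le_mul_of_nonneg_left h3 (by positivity)
  have h5 := (hKC o (γ m)).1
  have h6 : 1 / (3 * K) * dist o (γ m) = (1 / K * dist o (γ m)) / 3 := by
    field_simp
  linarith

/-! ### Maps induced on the boundary at infinity -/

section Boundary

variable {X X' : Type*} [MetricSpace X] [MetricSpace X']

theorem PreservesGromovProd.tendsto {Φ : X → X'} (hΦ : PreservesGromovProd Φ) {ι : Type*}
    {l : Filter ι} {x y : ι → X} (o : X) (o' : X')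
    (h : Tendsto (fun i => gromovProd o (x i) (y i)) l atTop) :
    Tendsto (fun i => gromovProd o' (Φ (x i)) (Φ (y i))) l atTop := by
  obtain ⟨c, hc, E, hE⟩ := hΦ
  refine tendsto_atTop_mono (fun i => ?_)
    (tendsto_atTop_add_const_right _ (-E - dist (Φ o) o') (h.const_mul_atTop hc))
  have h1 := hE o (x i) (y i)
  have h2 := gromovProd_le_add_dist_base (Φ o) o' (Φ (x i)) (Φ (y i))
  linarith

theorem ConvergesToInfinity.map {Φ : X → X'} (hΦ : PreservesGromovProd Φ) {x : ℕ → X}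
    (hx : ConvergesToInfinity x) : ConvergesToInfinity (fun i => Φ (x i)) :=
  fun o' => hΦ.tendsto (x 0) o' (hx (x 0))

theorem ConvergesToInfinity.of_dist_le {x y : ℕ → X} {C : ℝ} (hx : ConvergesToInfinity x)
    (h : ∀ i, dist (x i) (y i) ≤ C) : ConvergesToInfinity y := fun o => by
  refine tendsto_atTop_mono (fun ij => ?_) (tendsto_atTop_add_const_right _ (-C - C) (hx o))
  have h1 := gromovProd_le_add_dist o (x ij.1) (x ij.2) (y ij.1) (y ij.2)
  have h2 := h ij.1
  have h3 := h ij.2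
  linarith

theorem ConvergesToInfinity.tendsto_gromovProd_of_dist_le {x y : ℕ → X} {C : ℝ}
    (hx : ConvergesToInfinity x) (h : ∀ i, dist (x i) (y i) ≤ C) (o : X) :
    Tendsto (fun i => gromovProd o (x i) (y i)) atTop atTop := by
  refine tendsto_atTop_mono (fun i => ?_) (tendsto_atTop_add_const_right _ (-C)
    ((hx o).comp (tendsto_atTop_diagonal (α := ℕ))))
  have h1 := gromovProd_le_add_dist o (x i) (x i) (x i) (y i)
  have h2 := h i
  simp only [Function.comp_apply, dist_self] at h1 ⊢
  linarith

variable [IsGromovHyperbolic X] [IsGromovHyperbolic X']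

theorem VisualBoundary.mk_eq_mk {x y : SeqToInfinity X} :
    VisualBoundary.mk x = VisualBoundary.mk y ↔
      ∀ o : X, Tendsto (fun i : ℕ => gromovProd o (x.1 i) (y.1 i)) atTop atTop :=
  Quotient.eq (r := seqToInfinitySetoid X)

theorem VisualBoundary.mk_eq_mk_of_dist_le {x y : SeqToInfinity X} {C : ℝ}
    (h : ∀ i, dist (x.1 i) (y.1 i) ≤ C) : VisualBoundary.mk x = VisualBoundary.mk y :=
  VisualBoundary.mk_eq_mk.2 (x.2.tendsto_gromovProd_of_dist_le h)

theorem VisualBoundary.exists_rep (ξ : VisualBoundary X) : ∃ x, VisualBoundary.mk x = ξ :=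
  Quotient.exists_rep ξ

/-- The image of a sequence converging to infinity. -/
def SeqToInfinity.map {Φ : X → X'} (hΦ : PreservesGromovProd Φ) (x : SeqToInfinity X) :
    SeqToInfinity X' :=
  ⟨fun i => Φ (x.1 i), x.2.map hΦ⟩

/-- The map `[(x i)] ↦ [(Φ (x i))]`. -/
def VisualBoundary.map {Φ : X → X'} (hΦ : PreservesGromovProd Φ) :
    VisualBoundary X → VisualBoundary X' :=
  Quotient.lift (fun x => VisualBoundary.mk (x.map hΦ)) fun x _ h =>
    VisualBoundary.mk_eq_mk.2 fun o' => hΦ.tendsto (x.1 0) o' (h (x.1 0))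

theorem VisualBoundary.map_mk {Φ : X → X'} (hΦ : PreservesGromovProd Φ) (x : SeqToInfinity X) :
    VisualBoundary.map hΦ (VisualBoundary.mk x) = VisualBoundary.mk (x.map hΦ) :=
  rfl

theorem VisualBoundary.isVisualBoundaryMap_map {Φ : X → X'} (hΦ : PreservesGromovProd Φ) :
    IsVisualBoundaryMap Φ (VisualBoundary.map hΦ) :=
  fun x => ⟨x.map hΦ, fun _ => rfl, rfl⟩

theorem VisualBoundary.map_leftInverse {Φ : X → X'} {Θ : X' → X} (hΦ : PreservesGromovProd Φ)
    (hΘ : PreservesGromovProd Θ) {C : ℝ} (h : ∀ x, dist (Θ (Φ x)) x ≤ C) :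
    Function.LeftInverse (VisualBoundary.map hΘ) (VisualBoundary.map hΦ) := by
  intro ξ
  obtain ⟨x, rfl⟩ := ξ.exists_rep
  exact VisualBoundary.mk_eq_mk_of_dist_le fun i => h (x.1 i)

theorem DefinesPoint.map {Φ : X → X'} (hΦ : PreservesGromovProd Φ) {a : ℝ} {γ : ℝ → X}
    {ξ : VisualBoundary X} (h : DefinesPoint a γ ξ) :
    DefinesPoint a (fun t => Φ (γ t)) (VisualBoundary.map hΦ ξ) := by
  intro t ht hm htop
  obtain ⟨hc, rfl⟩ := h t ht hm htop
  exact ⟨hc.map hΦ, rfl⟩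

theorem DefinesPoint.of_dist_le {a C : ℝ} {γ β : ℝ → X} {ξ : VisualBoundary X}
    (h : DefinesPoint a γ ξ) (hd : ∀ t, dist (γ t) (β t) ≤ C) : DefinesPoint a β ξ := by
  intro t ht hm htop
  obtain ⟨hc, rfl⟩ := h t ht hm htop
  have hc' := hc.of_dist_le (y := fun i => β (t i)) fun i => hd (t i)
  exact ⟨hc', (VisualBoundary.mk_eq_mk_of_dist_le (x := ⟨_, hc⟩) (y := ⟨_, hc'⟩)
    fun i => hd (t i)).symm⟩

theorem DefinesPoint.unique {a : ℝ} {γ : ℝ → X} {ξ η : VisualBoundary X}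
    (h : DefinesPoint a γ ξ) (h' : DefinesPoint a γ η) : ξ = η := by
  have h1 : ∀ i : ℕ, a ≤ a + i := fun i => by simp
  have h2 : Monotone fun i : ℕ => a + (i : ℝ) := fun i j hij => by simpa using hij
  have h3 : Tendsto (fun i : ℕ => a + (i : ℝ)) atTop atTop :=
    tendsto_atTop_add_const_left _ _ tendsto_natCast_atTop_atTop
  obtain ⟨hc, rfl⟩ := h _ h1 h2 h3
  obtain ⟨_, rfl⟩ := h' _ h1 h2 h3
  rfl

theorem eventually_lt_of_lt_boundaryGromovProd {o : X} {x y : SeqToInfinity X} {R : ℝ}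
    (h : (R : EReal) < boundaryGromovProd o (VisualBoundary.mk x) (VisualBoundary.mk y)) :
    ∀ᶠ i in atTop, R < gromovProd o (x.1 i) (y.1 i) := by
  have h1 : (R : EReal) <
      liminf (fun i : ℕ => ((gromovProd o (x.1 i) (y.1 i) : ℝ) : EReal)) atTop :=
    h.trans_le (iInf_le_of_le x (iInf_le_of_le rfl (iInf_le_of_le y (iInf_le _ rfl))))
  exact (eventually_lt_of_lt_liminf h1).mono fun i hi => EReal.coe_lt_coe_iff.1 hi

/-- The infimum over representatives makes the hypothesis available for any chosen pair x, y. The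
conclusion concerns all representatives of the image points, which are compared with Φ ∘ x and Φ ∘ y
by two uses of hyperbolicity. -/
theorem PreservesGromovProd.exists_lt_boundaryGromovProd_map {Φ : X → X'}
    (hΦ : PreservesGromovProd Φ) (o : X) (o' : X') (S : ℝ) :
    ∃ R : ℝ, 0 ≤ R ∧ ∀ ξ η : VisualBoundary X, (R : EReal) < boundaryGromovProd o ξ η →
      (S : EReal) < boundaryGromovProd o' (VisualBoundary.map hΦ ξ) (VisualBoundary.map hΦ η) := by
  obtain ⟨δ, hδ0, hδ⟩ := IsGromovHyperbolic.exists_delta (X := X')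
  obtain ⟨c, hc, E, hE⟩ := id hΦ
  -- 2δ for the two comparisons, and 1 to keep the inequality strict in the liminf.
  set T := S + 1 + 2 * δ with hT
  refine ⟨max 0 ((T + dist (Φ o) o' + E) / c), le_max_left _ _, fun ξ η h => ?_⟩
  obtain ⟨x, rfl⟩ := ξ.exists_rep
  obtain ⟨y, rfl⟩ := η.exists_rep
  have hxy : ∀ᶠ i in atTop, T ≤ gromovProd o' (Φ (x.1 i)) (Φ (y.1 i)) := by
    filter_upwards [eventually_lt_of_lt_boundaryGromovProd h] with i hi
    have h1 := hE o (x.1 i) (y.1 i)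
    have h2 := gromovProd_le_add_dist_base (Φ o) o' (Φ (x.1 i)) (Φ (y.1 i))
    have h3 := (div_lt_iff₀ hc).1 ((le_max_right _ _).trans_lt hi)
    linarith
  refine lt_of_lt_of_le (EReal.coe_lt_coe_iff.2 (lt_add_one S)) ?_
  refine le_iInf₂ fun x' hx' => le_iInf₂ fun y' hy' => ?_
  refine le_liminf_of_le (by isBoundedDefault) ?_
  rw [VisualBoundary.map_mk, VisualBoundary.mk_eq_mk] at hx' hy'
  filter_upwards [hxy, tendsto_atTop.1 (hx' o') T, tendsto_atTop.1 (hy' o') T] with i h0 h1 h2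
  have h3 := hδ (x'.1 i) (Φ (y.1 i)) (Φ (x.1 i)) o'
  have h4 := hδ (x'.1 i) (y'.1 i) (Φ (y.1 i)) o'
  have h2' : T ≤ gromovProd o' (Φ (y.1 i)) (y'.1 i) := by rw [gromovProd_comm]; exact h2
  have h5 := le_min (show T ≤ gromovProd o' (x'.1 i) (Φ (x.1 i)) from h1) h0
  have h6 : T - δ ≤ gromovProd o' (x'.1 i) (Φ (y.1 i)) := by linarith
  have h7 := le_min h6 (show T - δ ≤ gromovProd o' (Φ (y.1 i)) (y'.1 i) by linarith)
  exact EReal.coe_le_coe_iff.2 (by linarith)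

theorem VisualBoundary.continuous_map {Φ : X → X'} (hΦ : PreservesGromovProd Φ) (o : X)
    (o' : X') :
    Continuous[visualTopology o, visualTopology o'] (VisualBoundary.map hΦ) := by
  refine @Continuous.mk _ _ (visualTopology o) (visualTopology o') _ fun U hU ξ hξ => ?_
  obtain ⟨S, -, hS⟩ := hU _ hξ
  obtain ⟨R, hR0, hR⟩ := hΦ.exists_lt_boundaryGromovProd_map o o' S
  exact ⟨R, hR0, fun η hη => hS (hR ξ η hη)⟩

end Boundary

/-! ### Quasi-inverses -/

theorem IsQuasiIsometry.exists_quasiInverse {X X' : Type*} [MetricSpace X] [MetricSpace X']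
    {Φ : X → X'} (hΦ : IsQuasiIsometry Φ) :
    ∃ Θ : X' → X, IsQuasiIsometry Θ ∧
      ∃ C : ℝ, (∀ x', dist (Φ (Θ x')) x' ≤ C) ∧ ∀ x, dist (Θ (Φ x)) x ≤ C := by
  obtain ⟨K, C, hK, hC, hKC, hsurj⟩ := hΦ
  choose Θ hΘ using hsurj
  have hK0 : 0 < K := by linarith
  have hlow : ∀ x y, dist x y ≤ K * (dist (Φ x) (Φ y) + C) := fun x y => by
    have h1 := (hKC x y).1
    rw [← div_le_iff₀' hK0, div_eq_inv_mul, ← one_div]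
    linarith
  have hinv : ∀ x, dist (Θ (Φ x)) x ≤ K * (3 * C) := fun x =>
    (hlow _ _).trans (mul_le_mul_of_nonneg_left (by linarith [hΘ (Φ x)]) hK0.le)
  -- In 3C, two summands come from replacing Φ (Θ x), Φ (Θ y) by x, y and one from the lower bound
  -- for Φ.
  refine ⟨Θ, ⟨K, K * (3 * C), hK, by positivity, fun x y => ⟨?_, ?_⟩,
    fun x => ⟨Φ x, hinv x⟩⟩, K * (3 * C), fun x' => (hΘ x').trans ?_, hinv⟩
  · have h1 := (hKC (Θ x) (Θ y)).2
    have h2 := dist_triangle4 x (Φ (Θ x)) (Φ (Θ y)) y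
    rw [dist_comm x (Φ (Θ x))] at h2
    have h3 := hΘ x
    have h4 := hΘ y
    have h6 : C ≤ K * C := le_mul_of_one_le_left hC hK
    have h7 : K * C ≤ K * (K * C) := mul_le_mul_of_nonneg_left h6 hK0.le
    have h5 : dist x y ≤ K * (dist (Θ x) (Θ y) + K * (3 * C)) := by linarith
    rw [one_div, sub_le_iff_le_add, inv_mul_le_iff₀ hK0]
    exact h5
  · have h2 := dist_triangle4 (Φ (Θ x)) x y (Φ (Θ y))
    rw [dist_comm y (Φ (Θ y))] at h2
    have h3 := hΘ x
    have h4 := hΘ y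
    refine (hlow _ _).trans ?_
    rw [← mul_add]
    exact mul_le_mul_of_nonneg_left (by linarith) hK0.le
  · nlinarith

theorem IsQuasiIsometry.isCoarselyLipschitz {X X' : Type*} [MetricSpace X] [MetricSpace X']
    {Φ : X → X'} (hΦ : IsQuasiIsometry Φ) : IsCoarselyLipschitz Φ := by
  obtain ⟨K, C, hK, hC, h, -⟩ := hΦ
  exact ⟨K, C, hK, hC, fun x y => (h x y).2⟩

theorem IsCoarselyLipschitz.comp {X Y Z : Type*} [MetricSpace X] [MetricSpace Y] [MetricSpace Z]
    {f : Y → Z} {g : X → Y} (hf : IsCoarselyLipschitz f) (hg : IsCoarselyLipschitz g) :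
    IsCoarselyLipschitz fun x => f (g x) := by
  obtain ⟨K, C, hK, hC, h⟩ := hf
  obtain ⟨K', C', hK', hC', h'⟩ := hg
  refine ⟨K * K', K * C' + C, by nlinarith, by positivity, fun x y => ?_⟩
  have h1 := mul_le_mul_of_nonneg_left (h' x y) (zero_le_one.trans hK)
  have h2 := h (g x) (g y)
  linarith

section Equivariance

variable {G : Type*} [Group G] {X Y Z : Type*} [MetricSpace X] [MetricSpace Y] [MetricSpace Z]
  [MulAction G X] [MulAction G Y] [MulAction G Z]

theorem IsCoarselyEquivariant.comp {f : Y → Z} {g : X → Y} (hf : IsCoarselyEquivariant G f)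
    (hfL : IsCoarselyLipschitz f) (hg : IsCoarselyEquivariant G g) :
    IsCoarselyEquivariant G fun x => f (g x) := by
  obtain ⟨A, hA⟩ := hf
  obtain ⟨K, C, hK, hC, h⟩ := hfL
  obtain ⟨B, hB⟩ := hg
  refine ⟨K * B + C + A, fun a x => ?_⟩
  have h1 := h (g (a • x)) (a • g x)
  have h2 := mul_le_mul_of_nonneg_left (hB a x) (zero_le_one.trans hK)
  have h3 := hA a (g x)
  have h4 := dist_triangle (f (g (a • x))) (f (a • g x)) (a • f (g x))
  linarith

/-- Both g (a • y) and a • g y are close to g (f (a • g y)): the former by equivariance of f, the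
latter because g ∘ f is close to the identity. -/
theorem IsCoarselyEquivariant.quasiInverse [IsIsometricSMul G Y] {f : X → Y} {g : Y → X}
    (hf : IsCoarselyEquivariant G f) (hg : IsCoarselyLipschitz g) {C : ℝ}
    (hfg : ∀ y, dist (f (g y)) y ≤ C) (hgf : ∀ x, dist (g (f x)) x ≤ C) :
    IsCoarselyEquivariant G g := by
  obtain ⟨A, hA⟩ := hf
  obtain ⟨K, B, hK, hB, h⟩ := hg
  refine ⟨K * (C + A) + B + C, fun a y => ?_⟩
  have h1 := dist_triangle (g (a • y)) (g (f (a • g y))) (a • g y)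
  have h2 := hgf (a • g y)
  have h3 := h (a • y) (f (a • g y))
  have h4 := dist_triangle (a • y) (a • f (g y)) (f (a • g y))
  rw [dist_smul, dist_comm y, dist_comm (a • f (g y))] at h4
  have h5 : dist (a • y) (f (a • g y)) ≤ C + A := by linarith [hfg y, hA a (g y)]
  have h6 := mul_le_mul_of_nonneg_left h5 (zero_le_one.trans hK)
  linarith

theorem IsInducedProjection.comp {f : Y → Z} {g : X → Y} (hf : IsInducedProjection G f)
    (hg : IsInducedProjection G g) : IsInducedProjection G fun x => f (g x) :=
  ⟨hf.1.comp hg.1, hf.2.comp hf.1 hg.2⟩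

/-- Induced projections are unique up to bounded distance. -/
theorem IsInducedProjection.exists_dist_le [IsIsometricSMul G Y]
    (hX : ∃ B : Set X, Bornology.IsBounded B ∧ ∀ x : X, ∃ (g : G) (b : X), b ∈ B ∧ g • b = x)
    {p q : X → Y} (hp : IsInducedProjection G p) (hq : IsInducedProjection G q) :
    ∃ C : ℝ, ∀ x, dist (p x) (q x) ≤ C := by
  obtain ⟨B, hB, hcov⟩ := hX
  obtain ⟨⟨K, C, hK, hC, hpL⟩, A, hA⟩ := hp
  obtain ⟨⟨K', C', hK', hC', hqL⟩, A', hA'⟩ := hq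
  rcases isEmpty_or_nonempty X with h0 | ⟨⟨x₀⟩⟩
  · exact ⟨0, fun x => isEmptyElim x⟩
  obtain ⟨r, hr⟩ := hB.subset_closedBall x₀
  refine ⟨A + (K * r + C) + dist (p x₀) (q x₀) + (K' * r + C') + A', fun x => ?_⟩
  obtain ⟨g, b, hb, rfl⟩ := hcov x
  have hbr : dist b x₀ ≤ r := hr hb
  have h1 := hA g b
  have h2 := hA' g b
  have h3 := hpL b x₀
  have h4 := hqL b x₀
  have h5 := mul_le_mul_of_nonneg_left hbr (zero_le_one.trans hK)
  have h6 := mul_le_mul_of_nonneg_left hbr (zero_le_one.trans hK')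
  have h7 := dist_triangle4 (p (g • b)) (g • p b) (g • q b) (q (g • b))
  have h8 := dist_triangle4 (p b) (p x₀) (q x₀) (q b)
  rw [dist_smul, dist_comm (g • q b)] at h7
  rw [dist_comm (q x₀) (q b)] at h8
  linarith

end Equivariance

/-! ### Quasi-isometries and sublinear neighbourhoods -/

/-- Concavity gives κ(Kt) ≤ K κ(t), subadditivity splits off κ(C), and κ(C) is absorbed because κ(t)
≥ κ(0) > 0. -/
theorem SublinearFunction.exists_le_mul (κ : SublinearFunction) {K C : ℝ} (hK : 1 ≤ K)
    (hC : 0 ≤ C) :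
    ∃ M : ℝ, 0 ≤ M ∧ ∀ s t : ℝ, 0 ≤ s → 0 ≤ t → s ≤ K * t + C → κ.toFun s ≤ M * κ.toFun t := by
  have hK0 : 0 < K := by linarith
  have h0 := κ.pos 0 le_rfl
  have hκC := κ.pos C hC
  refine ⟨K + κ.toFun C / κ.toFun 0, by positivity, fun s t hs ht hst => ?_⟩
  have hKt : 0 ≤ K * t := by positivity
  have h1 : κ.toFun s ≤ κ.toFun (K * t + C) := κ.mono hs (hs.trans hst) hst
  have h2 := κ.add_le hKt hC
  have h3 : κ.toFun (K * t) ≤ K * κ.toFun t := by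
    rcases ht.eq_or_lt with rfl | ht'
    · rw [mul_zero]; exact le_mul_of_one_le_left h0.le hK
    · have h4 := κ.mul_le ht (le_mul_of_one_le_left ht hK) (mul_pos hK0 ht')
      rw [div_mul_cancel_right₀ ht'.ne'] at h4
      rwa [inv_mul_le_iff₀ hK0] at h4
  have h5 : κ.toFun 0 ≤ κ.toFun t := κ.mono (Set.mem_Ici.2 le_rfl) ht ht
  have h6 : κ.toFun C ≤ κ.toFun C / κ.toFun 0 * κ.toFun t := by
    rw [div_mul_eq_mul_div, le_div_iff₀ h0]
    exact mul_le_mul_of_nonneg_left h5 hκC.le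
  linarith

theorem Metric.infDist_image_le {Y Y' : Type*} [MetricSpace Y] [MetricSpace Y'] {Ψ : Y → Y'}
    {K C : ℝ} (hK : 0 ≤ K) (h : ∀ x y, dist (Ψ x) (Ψ y) ≤ K * dist x y + C) {Z : Set Y}
    (hZ : Z.Nonempty) (y : Y) :
    Metric.infDist (Ψ y) (Ψ '' Z) ≤ K * (Metric.infDist y Z + 1) + C := by
  obtain ⟨z, hz, hyz⟩ := (Metric.infDist_lt_iff hZ).1 (lt_add_one (Metric.infDist y Z))
  refine (Metric.infDist_le_dist_of_mem (Set.mem_image_of_mem Ψ hz)).trans ((h y z).trans ?_)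
  linarith [mul_le_mul_of_nonneg_left hyz.le hK]

section KappaMaps

variable {Y Y' : Type*} [MetricSpace Y] [MetricSpace Y'] {κ : SublinearFunction}

/-- The constant n' does not depend on Z or on the points, as Morse gauges require. The slack B
serves points of Y' that lie only near the image of Ψ. -/
theorem IsQuasiIsometry.exists_mem_kappaNeighborhood {Ψ : Y → Y'} (hΨ : IsQuasiIsometry Ψ)
    (κ : SublinearFunction) (o : Y) (o' : Y') (n B : ℝ) :
    ∃ n' : ℝ, 0 ≤ n' ∧ ∀ (Z : Set Y) (y : Y) (y' : Y'), Z.Nonempty →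
      y ∈ kappaNeighborhood κ o Z n → dist y' (Ψ y) ≤ B →
      y' ∈ kappaNeighborhood κ o' (Ψ '' Z) n' := by
  obtain ⟨K, C, hK, hC, hKC, -⟩ := hΨ
  have hK0 : 0 < K := by linarith
  obtain ⟨M, hM, hκ⟩ := κ.exists_le_mul hK
    (show 0 ≤ K * (dist (Ψ o) o' + |B| + C) by positivity)
  have h0 := κ.pos 0 le_rfl
  refine ⟨K * |n| * M + (|B| + K + C) / κ.toFun 0, by positivity, fun Z y y' hZ hy hyy' => ?_⟩
  change Metric.infDist y Z ≤ n * κ.toFun (dist o y) at hy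
  change Metric.infDist y' (Ψ '' Z) ≤ _
  have h1 : Metric.infDist y' (Ψ '' Z) ≤ Metric.infDist (Ψ y) (Ψ '' Z) + dist y' (Ψ y) :=
    Metric.infDist_le_infDist_add_dist
  have h2 := Metric.infDist_image_le hK0.le (fun x y => (hKC x y).2) hZ y
  have hB := le_abs_self B
  have h3 : dist o y ≤ K * dist o' y' + K * (dist (Ψ o) o' + |B| + C) := by
    have h4 := (hKC o y).1
    have h5 := dist_triangle4 (Ψ o) o' y' (Ψ y)
    rw [← mul_add, ← div_le_iff₀' hK0, div_eq_inv_mul, ← one_div]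
    linarith
  have h6 := hκ _ _ dist_nonneg dist_nonneg h3
  have h7 : κ.toFun 0 ≤ κ.toFun (dist o' y') :=
    κ.mono (Set.mem_Ici.2 le_rfl) (Set.mem_Ici.2 dist_nonneg) dist_nonneg
  have h8 : |B| + K + C ≤ (|B| + K + C) / κ.toFun 0 * κ.toFun (dist o' y') := by
    rw [div_mul_eq_mul_div, le_div_iff₀ h0]
    exact mul_le_mul_of_nonneg_left h7 (by positivity)
  have h9 : n * κ.toFun (dist o y) ≤ |n| * (M * κ.toFun (dist o' y')) :=
    (mul_le_mul_of_nonneg_right (le_abs_self n) (κ.pos _ dist_nonneg).le).trans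
      (mul_le_mul_of_nonneg_left h6 (abs_nonneg n))
  have h10 := mul_le_mul_of_nonneg_left (hy.trans h9) hK0.le
  linarith

/-- A quasi-geodesic in Y' is pulled back to Y, where the Morse property of Z applies, and the
resulting neighbourhood is pushed forward. The pull-back may be discontinuous, which quasi-geodesics
are allowed to be. -/
theorem IsKappaMorse.image {o : Y} {Z : Set Y} (hZM : IsKappaMorse κ o Z) (hZ : Z.Nonempty)
    (o' : Y') {Ψ : Y → Y'} (hΨ : IsQuasiIsometry Ψ) : IsKappaMorse κ o' (Ψ '' Z) := by
  obtain ⟨μ, -, hμ⟩ := hZM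
  obtain ⟨K, C, hK, hC, hKC, hsurj⟩ := id hΨ
  have hK0 : 0 < K := by linarith
  -- The coarse inverse must send points of Ψ '' Z into Z itself, not merely near it: the Morse
  -- condition speaks of endpoints on Z.
  have hpre : ∀ y' : Y', ∃ y : Y, dist (Ψ y) y' ≤ C ∧ (y' ∈ Ψ '' Z → y ∈ Z) := by
    intro y'
    by_cases hy : y' ∈ Ψ '' Z
    · obtain ⟨z, hz, rfl⟩ := hy
      exact ⟨z, by rwa [dist_self], fun _ => hz⟩
    · obtain ⟨y, hy'⟩ := hsurj y'
      exact ⟨y, hy', fun h => absurd h hy⟩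
  choose θ hθ hθZ using hpre
  choose n' hn'0 hn' using fun n : ℝ => hΨ.exists_mem_kappaNeighborhood κ o o' n C
  refine ⟨fun K' C' => n' (μ (K * K') (K * (C' + 3 * C))), fun _ _ => hn'0 _,
    fun K' C' hK' hC' s t β hst hβ hs ht => ?_⟩
  have hK'0 : 0 < K' := by linarith
  have hqg : IsQuasiGeodesicOn (K * K') (K * (C' + 3 * C)) (Set.Icc s t) (fun r => θ (β r)) := by
    intro r hr u hu
    obtain ⟨h1, h2⟩ := hβ r hr u hu
    obtain ⟨h3, h4⟩ := hKC (θ (β r)) (θ (β u))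
    have h5 := dist_triangle4 (Ψ (θ (β r))) (β r) (β u) (Ψ (θ (β u)))
    have h6 := dist_triangle4 (β r) (Ψ (θ (β r))) (Ψ (θ (β u))) (β u)
    have h7 := hθ (β r)
    have h8 := hθ (β u)
    rw [dist_comm (β u)] at h5
    rw [dist_comm (β r) (Ψ _)] at h6
    constructor
    · have h9 : 1 / K' * |r - u| ≤ K * dist (θ (β r)) (θ (β u)) + (C' + 3 * C) := by linarith
      have h10 : 1 / (K * K') * |r - u| = (1 / K' * |r - u|) / K := by field_simp
      have h11 : C' + 3 * C ≤ K * (K * (C' + 3 * C)) := by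
        have := le_mul_of_one_le_left (show 0 ≤ C' + 3 * C by positivity) hK
        exact this.trans (mul_le_mul_of_nonneg_left this hK0.le)
      rw [h10, sub_le_iff_le_add, div_le_iff₀' hK0]
      linarith
    · have h9 : dist (θ (β r)) (θ (β u)) ≤ K * (K' * |r - u| + C' + 3 * C) := by
        rw [← div_le_iff₀' hK0, div_eq_inv_mul, ← one_div]
        linarith
      linarith
  have hsub := hμ (K * K') (K * (C' + 3 * C)) (by nlinarith) (by positivity) s t _ hst hqg
    (hθZ _ hs) (hθZ _ ht)
  rintro _ ⟨r, hr, rfl⟩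
  exact hn' _ Z (θ (β r)) (β r) hZ (hsub ⟨r, hr, rfl⟩) (by rw [dist_comm]; exact hθ _)

/-- The image of a quasi-geodesic ray under a quasi-isometry. -/
def QuasiGeodesicRay.map {Ψ : Y → Y'} (hΨ : IsQuasiIsometry Ψ) (γ : QuasiGeodesicRay Y) :
    QuasiGeodesicRay Y' where
  start := γ.start
  toFun t := Ψ (γ.toFun t)
  quasiGeodesic := by
    obtain ⟨K, C, hK, hC, hKC, -⟩ := hΨ
    obtain ⟨K', C', hK', hC', hγ⟩ := γ.quasiGeodesic
    have hK0 : 0 < K := by linarith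
    have hK'0 : 0 < K' := by linarith
    refine ⟨K * K', K * C' + C, by nlinarith, by positivity, fun s hs t ht => ?_⟩
    obtain ⟨h1, h2⟩ := hγ s hs t ht
    obtain ⟨h3, h4⟩ := hKC (γ.toFun s) (γ.toFun t)
    constructor
    · have h5 : 1 / (K * K') * |s - t| = 1 / K * (1 / K' * |s - t|) := by field_simp
      have h6 : 1 / K * (1 / K' * |s - t| - C') ≤ 1 / K * dist (γ.toFun s) (γ.toFun t) :=
        mul_le_mul_of_nonneg_left h1 (by positivity)
      have h7 : 1 / K * C' ≤ K * C' :=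
        mul_le_mul_of_nonneg_right (((div_le_one hK0).2 hK).trans hK) hC'
      linarith
    · have := mul_le_mul_of_nonneg_left h2 hK0.le
      linarith

theorem QuasiGeodesicRay.image_map {Ψ : Y → Y'} (hΨ : IsQuasiIsometry Ψ)
    (γ : QuasiGeodesicRay Y) : (γ.map hΨ).image = Ψ '' γ.image :=
  (Set.image_image Ψ γ.toFun _).symm

theorem KappaFellowTravel.map {Ψ : Y → Y'} (hΨ : IsQuasiIsometry Ψ) {o : Y} (o' : Y')
    {α β : QuasiGeodesicRay Y} (h : KappaFellowTravel κ o α β) :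
    KappaFellowTravel κ o' (α.map hΨ) (β.map hΨ) := by
  have key : ∀ {α β : QuasiGeodesicRay Y} {n : ℝ}, α.image ⊆ kappaNeighborhood κ o β.image n →
      ∃ m : ℝ, (α.map hΨ).image ⊆ kappaNeighborhood κ o' (β.map hΨ).image m := by
    intro α β n hn
    obtain ⟨m, -, hm⟩ := hΨ.exists_mem_kappaNeighborhood κ o o' n 0
    refine ⟨m, ?_⟩
    rw [QuasiGeodesicRay.image_map, QuasiGeodesicRay.image_map]
    rintro _ ⟨y, hy, rfl⟩
    exact hm _ y _ β.image_nonempty (hn hy) (dist_self _).le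
  obtain ⟨⟨n, hn⟩, m, hm⟩ := h
  exact ⟨key hn, key hm⟩

theorem kappaFellowTravel_of_dist_le (o : Y) {α β : QuasiGeodesicRay Y} {C : ℝ}
    (hstart : α.start = β.start) (h : ∀ t, dist (α.toFun t) (β.toFun t) ≤ C) :
    KappaFellowTravel κ o α β := by
  have h0 := κ.pos 0 le_rfl
  have key : ∀ {α β : QuasiGeodesicRay Y}, α.start = β.start →
      (∀ t, dist (α.toFun t) (β.toFun t) ≤ C) →
      α.image ⊆ kappaNeighborhood κ o β.image (C / κ.toFun 0) := by
    rintro α β hstart h _ ⟨t, ht, rfl⟩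
    change Metric.infDist _ _ ≤ _
    refine (Metric.infDist_le_dist_of_mem (s := β.image) (y := β.toFun t)
      ⟨t, hstart ▸ ht, rfl⟩).trans ((h t).trans ?_)
    rw [div_mul_eq_mul_div, le_div_iff₀ h0]
    exact mul_le_mul_of_nonneg_left (κ.mono (Set.mem_Ici.2 le_rfl) (Set.mem_Ici.2 dist_nonneg)
      dist_nonneg) (dist_nonneg.trans (h t))
  exact ⟨⟨_, key hstart h⟩, _, key hstart.symm fun t => by rw [dist_comm]; exact h t⟩

/-- The image of a `κ`-Morse quasi-geodesic ray under a quasi-isometry. -/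
def KappaMorseRay.map {Ψ : Y → Y'} (hΨ : IsQuasiIsometry Ψ) {o : Y} (o' : Y')
    (γ : KappaMorseRay κ o) : KappaMorseRay κ o' :=
  ⟨γ.1.map hΨ, by
    rw [QuasiGeodesicRay.image_map]
    exact γ.2.image γ.1.image_nonempty o' hΨ⟩

theorem KappaBoundary.mk_eq_mk {o : Y} {α β : KappaMorseRay κ o} :
    KappaBoundary.mk α = KappaBoundary.mk β ↔ KappaFellowTravel κ o α.1 β.1 :=
  Quotient.eq (r := kappaMorseRaySetoid κ o)

theorem KappaBoundary.exists_rep {o : Y} (ξ : KappaBoundary κ o) : ∃ γ, KappaBoundary.mk γ = ξ :=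
  Quotient.exists_rep ξ

/-- The map `[γ] ↦ [Ψ ∘ γ]`. -/
def KappaBoundary.map {Ψ : Y → Y'} (hΨ : IsQuasiIsometry Ψ) {o : Y} (o' : Y') :
    KappaBoundary κ o → KappaBoundary κ o' :=
  Quotient.lift (fun γ => KappaBoundary.mk (γ.map hΨ o')) fun _ _ h =>
    KappaBoundary.mk_eq_mk.2 (KappaFellowTravel.map hΨ o' h)

theorem KappaBoundary.map_mk {Ψ : Y → Y'} (hΨ : IsQuasiIsometry Ψ) {o : Y} (o' : Y')
    (γ : KappaMorseRay κ o) :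
    KappaBoundary.map hΨ o' (KappaBoundary.mk γ) = KappaBoundary.mk (γ.map hΨ o') :=
  rfl

theorem KappaBoundary.isKappaBoundaryMap_map {Ψ : Y → Y'} (hΨ : IsQuasiIsometry Ψ) {o : Y}
    (o' : Y') : IsKappaBoundaryMap (κ := κ) (o := o) Ψ (KappaBoundary.map hΨ o') :=
  fun γ => ⟨γ.map hΨ o', rfl, fun _ => rfl, rfl⟩

theorem KappaBoundary.map_leftInverse {Ψ : Y → Y'} {Θ : Y' → Y} (hΨ : IsQuasiIsometry Ψ)
    (hΘ : IsQuasiIsometry Θ) {C : ℝ} (h : ∀ y, dist (Θ (Ψ y)) y ≤ C) (o : Y) (o' : Y') :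
    Function.LeftInverse (KappaBoundary.map (κ := κ) (o := o') hΘ o)
      (KappaBoundary.map (o := o) hΨ o') := by
  intro ξ
  obtain ⟨γ, rfl⟩ := ξ.exists_rep
  exact KappaBoundary.mk_eq_mk.2 (kappaFellowTravel_of_dist_le o rfl fun t => h (γ.1.toFun t))

end KappaMaps

/-! ### Geometric actions of the same group -/

/-- In a geodesic space, a map with bounded displacement of points at distance at most `1` is
coarsely Lipschitz. -/
theorem IsGeodesicSpace.dist_le_of_forall_dist_le_one {Y Z : Type*} [MetricSpace Y]
    [MetricSpace Z] (hY : IsGeodesicSpace Y) {f : Y → Z} {L : ℝ}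
    (hf : ∀ x y, dist x y ≤ 1 → dist (f x) (f y) ≤ L) (x y : Y) :
    dist (f x) (f y) ≤ L * dist x y + L := by
  have hL : 0 ≤ L := dist_nonneg.trans (hf x x (by simp))
  obtain ⟨γ, hγ0, hγ1, hγ⟩ := hY x y
  have key : ∀ n : ℕ, ∀ t ∈ Set.Icc 0 (dist x y), t ≤ n → dist (f x) (f (γ t)) ≤ L * n := by
    intro n
    induction n with
    | zero =>
      intro t ht htn
      have : t = 0 := le_antisymm (by simpa using htn) ht.1
      rw [this, hγ0]
      simp
    | succ n ih =>
      intro t ht htn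
      push_cast at htn ⊢
      set u := max 0 (t - 1) with hu
      have hut : u ≤ t := max_le ht.1 (by linarith)
      have hut1 : t - 1 ≤ u := le_max_right _ _
      have huI : u ∈ Set.Icc 0 (dist x y) := ⟨le_max_left _ _, hut.trans ht.2⟩
      have h1 := ih u huI (max_le (by positivity) (by linarith))
      have h2 := hf (γ u) (γ t) (by
        rw [hγ u huI t ht, abs_sub_comm, abs_of_nonneg (by linarith)]; linarith)
      have h3 := dist_triangle (f x) (f (γ u)) (f (γ t))
      linarith
  have h1 := key ⌈dist x y⌉₊ (dist x y) ⟨dist_nonneg, le_rfl⟩ (Nat.le_ceil _)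
  have h2 := (Nat.ceil_lt_add_one (dist_nonneg (x := x) (y := y))).le
  rw [hγ1] at h1
  have h3 := mul_le_mul_of_nonneg_left h2 hL
  linarith

section Actions

variable {G : Type*} [Group G] {Y Y' : Type*} [MetricSpace Y] [MetricSpace Y'] [MulAction G Y]
  [MulAction G Y']

theorem IsGeometricAction.exists_dist_smul_le (hY : IsGeometricAction G Y) (o : Y) :
    ∃ R : ℝ, 0 ≤ R ∧ ∀ y : Y, ∃ g : G, dist y (g • o) ≤ R := by
  obtain ⟨K, hK, hcov⟩ := hY.cocompact
  obtain ⟨r, hr⟩ := hK.isBounded.subset_closedBall o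
  refine ⟨max r 0, le_max_right _ _, fun y => ?_⟩
  obtain ⟨g, k, hk, rfl⟩ := hcov y
  have := hY.isometric
  refine ⟨g, ?_⟩
  rw [dist_smul]
  exact (hr hk : dist k o ≤ r).trans (le_max_left _ _)

/-- Orbit maps between geometric actions are coarsely Lipschitz. -/
theorem IsGeometricAction.exists_dist_orbit_le (hY : IsGeometricAction G Y)
    (hgeod : IsGeodesicSpace Y) [IsIsometricSMul G Y'] (o : Y) (o' : Y') :
    ∃ L : ℝ, 0 ≤ L ∧ ∀ g h : G, dist (g • o') (h • o') ≤ L * dist (g • o) (h • o) + L := by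
  have := hY.isometric
  obtain ⟨R, hR, hcov⟩ := hY.exists_dist_smul_le o
  choose f hf using hcov
  -- Properness leaves finitely many such g. The bound 2R + 1 is the distance between orbit points
  -- that are R-close to two points at distance at most 1.
  obtain ⟨L, hL⟩ : ∃ L : ℝ, ∀ g : G, dist (g • o) o ≤ 2 * R + 1 → dist (g • o') o' ≤ L := by
    obtain ⟨L, hL⟩ := ((hY.proper o (2 * R + 1)).image fun g : G => dist (g • o') o').bddAbove
    exact ⟨L, fun g hg => hL ⟨g, hg, rfl⟩⟩
  have hL' : ∀ g h : G, dist (g • o) (h • o) ≤ 2 * R + 1 → dist (g • o') (h • o') ≤ L := by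
    intro g h hgh
    have h2 : dist ((h⁻¹ * g) • o) o = dist (g • o) (h • o) := by
      rw [← dist_smul h, smul_smul, mul_inv_cancel_left]
    have h3 : dist ((h⁻¹ * g) • o') o' = dist (g • o') (h • o') := by
      rw [← dist_smul h, smul_smul, mul_inv_cancel_left]
    rw [← h3]
    exact hL _ (by rwa [h2])
  have hL0 : 0 ≤ L := dist_nonneg.trans (hL 1 (by rw [one_smul, dist_self]; linarith))
  have h1 := hgeod.dist_le_of_forall_dist_le_one (f := fun y => f y • o') (L := L)
    fun x y hxy => hL' _ _ (by
      have h2 := dist_triangle4 (f x • o) x y (f y • o)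
      rw [dist_comm (f x • o) x] at h2
      linarith [hf x, hf y])
  refine ⟨3 * L, by positivity, fun g h => ?_⟩
  have h2 : ∀ g : G, dist (g • o') (f (g • o) • o') ≤ L := fun g =>
    hL' _ _ ((hf _).trans (by linarith))
  have h3 := dist_triangle4 (g • o') (f (g • o) • o') (f (h • o) • o') (h • o')
  rw [dist_comm (f (h • o) • o')] at h3
  have h4 := h1 (g • o) (h • o)
  have h5 : 0 ≤ L * dist (g • o) (h • o) := by positivity
  linarith [h2 g, h2 h]

/-- Two geodesic spaces with geometric actions of the same group are equivariantly
quasi-isometric. -/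
theorem IsGeometricAction.actionEquivalent (hY : IsGeometricAction G Y)
    (hYg : IsGeodesicSpace Y) (hY' : IsGeometricAction G Y') (hY'g : IsGeodesicSpace Y')
    (o : Y) (o' : Y') : ActionEquivalent G Y Y' := by
  have := hY.isometric
  have := hY'.isometric
  obtain ⟨R, hR, hcov⟩ := hY.exists_dist_smul_le o
  obtain ⟨R', hR', hcov'⟩ := hY'.exists_dist_smul_le o'
  obtain ⟨L, hL, hLip⟩ := hY.exists_dist_orbit_le hYg o o'
  obtain ⟨L', hL', hLip'⟩ := hY'.exists_dist_orbit_le hY'g o' o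
  choose f hf using hcov
  set K := max 1 (max L L') with hK
  have hK1 : 1 ≤ K := le_max_left _ _
  have hKL : L ≤ K := (le_max_left _ _).trans (le_max_right _ _)
  have hKL' : L' ≤ K := (le_max_right _ _).trans (le_max_right _ _)
  have hK0 : 0 < K := by linarith
  have hKR : 0 ≤ K * R := by positivity
  refine ⟨fun y => f y • o', ⟨K, K * (2 * R) + K + 2 * R + R', hK1, by positivity,
    fun x y => ⟨?_, ?_⟩, fun y' => ?_⟩, L * (2 * R) + L, fun g y => ?_⟩
  · have h1 := hLip' (f x) (f y)
    have h2 := dist_triangle4 x (f x • o) (f y • o) y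
    rw [dist_comm (f y • o) y] at h2
    have h3 := mul_le_mul_of_nonneg_right hKL' (dist_nonneg (x := f x • o') (y := f y • o'))
    have h4 : 2 * R + K ≤ K * (2 * R + 1) := by
      linarith [le_mul_of_one_le_left (show 0 ≤ 2 * R by positivity) hK1]
    have h5 : dist x y ≤ K * (dist (f x • o') (f y • o') + (2 * R + 1)) := by
      linarith [hf x, hf y]
    have h6 : 1 / K * dist x y ≤ dist (f x • o') (f y • o') + (2 * R + 1) := by
      rwa [one_div, inv_mul_le_iff₀ hK0]
    linarith
  · have h1 := hLip (f x) (f y)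
    have h2 := dist_triangle4 (f x • o) x y (f y • o)
    rw [dist_comm (f x • o) x] at h2
    have h3 := mul_le_mul_of_nonneg_right hKL (dist_nonneg (x := f x • o) (y := f y • o))
    have h4 : K * dist (f x • o) (f y • o) ≤ K * (dist x y + 2 * R) :=
      mul_le_mul_of_nonneg_left (by linarith [hf x, hf y]) hK0.le
    linarith
  · obtain ⟨g, hg⟩ := hcov' y'
    refine ⟨g • o, ?_⟩
    have h1 := hLip (f (g • o)) g
    have h2 := hf (g • o)
    rw [dist_comm] at h2
    have h3 := mul_le_mul hKL h2 dist_nonneg hK0.le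
    have h4 := dist_triangle (f (g • o) • o') (g • o') y'
    rw [dist_comm (g • o') y'] at h4
    linarith
  -- Both f (g • y) and g * f y move o to within R of g • y.
  · have h1 := hLip (f (g • y)) (g * f y)
    have h2 := hf (g • y)
    have h3 := dist_triangle (f (g • y) • o) (g • y) ((g * f y) • o)
    rw [dist_comm (f (g • y) • o) (g • y), mul_smul, dist_smul] at h3
    have h4 : L * dist (f (g • y) • o) ((g * f y) • o) ≤ L * (2 * R) :=
      mul_le_mul_of_nonneg_left (by rw [mul_smul]; linarith [hf y]) hL
    rw [← mul_smul]
    linarith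

end Actions

/-! ### Transport of `κ`-injectivity -/

/-- The projections of `κ`-Morse quasi-geodesic rays under `p` define points at infinity, which
coincide exactly for fellow travelling rays. -/
def IsKappaInjectiveMap (κ : SublinearFunction) {Y X : Type*} [MetricSpace Y] [MetricSpace X]
    [IsGromovHyperbolic X] (o : Y) (p : Y → X) : Prop :=
  (∀ γ : KappaMorseRay κ o, ∃ ξ : VisualBoundary X,
      DefinesPoint γ.1.start (fun t => p (γ.1.toFun t)) ξ) ∧
    ∀ γ₁ γ₂ : KappaMorseRay κ o, KappaFellowTravel κ o γ₁.1 γ₂.1 ↔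
      ∃ ξ : VisualBoundary X, DefinesPoint γ₁.1.start (fun t => p (γ₁.1.toFun t)) ξ ∧
        DefinesPoint γ₂.1.start (fun t => p (γ₂.1.toFun t)) ξ

section Transport

variable {κ : SublinearFunction} {Y X Y' X' : Type*} [MetricSpace Y] [MetricSpace X]
  [MetricSpace Y'] [MetricSpace X'] [IsGromovHyperbolic X] [IsGromovHyperbolic X']

theorem IsKappaInjectiveMap.of_dist_le {o : Y} {p q : Y → X} (h : IsKappaInjectiveMap κ o p)
    {C : ℝ} (hpq : ∀ y, dist (p y) (q y) ≤ C) : IsKappaInjectiveMap κ o q := by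
  have hiff : ∀ (γ : KappaMorseRay κ o) (ξ : VisualBoundary X),
      DefinesPoint γ.1.start (fun t => p (γ.1.toFun t)) ξ ↔
        DefinesPoint γ.1.start (fun t => q (γ.1.toFun t)) ξ := fun γ ξ =>
    ⟨fun h => h.of_dist_le fun t => hpq _, fun h => h.of_dist_le fun t => by
      rw [dist_comm]; exact hpq _⟩
  simpa only [IsKappaInjectiveMap, hiff] using h

/-- Fellow travelling is reflected by Θ since ∂Θ has a left inverse. Φ need not reflect the property
of defining a point: the projections to X already define points, so injectivity of ∂Φ suffices. -/
theorem IsKappaInjectiveMap.comp {o : Y} {p : Y → X} (h : IsKappaInjectiveMap κ o p) (o' : Y')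
    {Θ : Y' → Y} (hΘ : IsQuasiIsometry Θ) {Φ : X → X'} (hΦ : PreservesGromovProd Φ)
    (hinj : Function.Injective (VisualBoundary.map hΦ)) :
    IsKappaInjectiveMap κ o' fun y => Φ (p (Θ y)) := by
  have hdef : ∀ γ : KappaMorseRay κ o', ∃ ξ : VisualBoundary X,
      DefinesPoint γ.1.start (fun t => p (Θ (γ.1.toFun t))) ξ := fun γ => h.1 (γ.map hΘ o)
  refine ⟨fun γ => ?_, fun γ₁ γ₂ => ?_⟩
  · obtain ⟨ξ, hξ⟩ := hdef γ
    exact ⟨_, hξ.map hΦ⟩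
  have hiff : KappaFellowTravel κ o' γ₁.1 γ₂.1 ↔
      KappaFellowTravel κ o (γ₁.map hΘ o).1 (γ₂.map hΘ o).1 := by
    obtain ⟨Ψ, hΨ, C, -, hC⟩ := hΘ.exists_quasiInverse
    have hinj := (KappaBoundary.map_leftInverse (κ := κ) hΘ hΨ hC o' o).injective
    rw [← KappaBoundary.mk_eq_mk, ← KappaBoundary.mk_eq_mk, ← KappaBoundary.map_mk,
      ← KappaBoundary.map_mk, hinj.eq_iff]
  rw [hiff, h.2]
  constructor
  · rintro ⟨ξ, h₁, h₂⟩
    exact ⟨_, h₁.map hΦ, h₂.map hΦ⟩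
  · rintro ⟨ξ', h₁, h₂⟩
    obtain ⟨ξ₁, hξ₁⟩ := hdef γ₁
    obtain ⟨ξ₂, hξ₂⟩ := hdef γ₂
    have : ξ₁ = ξ₂ := hinj (((hξ₁.map hΦ).unique h₁).trans ((hξ₂.map hΦ).unique h₂).symm)
    exact ⟨ξ₁, hξ₁, this ▸ hξ₂⟩

/-- The map `[γ] ↦ [p ∘ γ]` exists and is injective. -/
theorem IsKappaInjectiveMap.exists_boundaryMap {o : Y} {p : Y → X}
    (h : IsKappaInjectiveMap κ o p) :
    ∃ dp : KappaBoundary κ o → VisualBoundary X,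
      IsProjectionBoundaryMap p dp ∧ Function.Injective dp := by
  choose ξ hξ using h.1
  refine ⟨Quotient.lift ξ fun γ₁ γ₂ hγ => ?_, hξ, fun a b hab => ?_⟩
  · obtain ⟨η, h₁, h₂⟩ := (h.2 γ₁ γ₂).1 hγ
    exact ((hξ γ₁).unique h₁).trans ((hξ γ₂).unique h₂).symm
  · obtain ⟨γ₁, rfl⟩ := a.exists_rep
    obtain ⟨γ₂, rfl⟩ := b.exists_rep
    have hab' : ξ γ₁ = ξ γ₂ := hab
    exact KappaBoundary.mk_eq_mk.2 ((h.2 γ₁ γ₂).2 ⟨ξ γ₁, hξ γ₁, hab' ▸ hξ γ₂⟩)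

theorem KappaBoundary.isHomeomorph_map {o : Y} {o' : Y'} {Ψ : Y → Y'} (hΨ : IsQuasiIsometry Ψ)
    {Φ : X → X'} {Θ : X' → X} (hΦ : PreservesGromovProd Φ) (hΘ : PreservesGromovProd Θ)
    (hinv : Function.LeftInverse (VisualBoundary.map hΘ) (VisualBoundary.map hΦ))
    {dp : KappaBoundary κ o → VisualBoundary X} {dp' : KappaBoundary κ o' → VisualBoundary X'}
    (hcomm : ∀ ξ, dp' (KappaBoundary.map hΨ o' ξ) = VisualBoundary.map hΦ (dp ξ))
    (x₀ : X) (x₀' : X') :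
    @IsHomeomorph _ _ (projectionTopology x₀ dp) (projectionTopology x₀' dp')
      (KappaBoundary.map hΨ o') := by
  obtain ⟨Ω, hΩ, C, hC, hC'⟩ := hΨ.exists_quasiInverse
  have hl := KappaBoundary.map_leftInverse (κ := κ) hΨ hΩ hC' o o'
  have hr := KappaBoundary.map_leftInverse (κ := κ) hΩ hΨ hC o' o
  let := visualTopology x₀
  let := visualTopology x₀'
  let := projectionTopology x₀ dp
  let := projectionTopology x₀' dp'
  have hcΦ : Continuous (VisualBoundary.map hΦ) := VisualBoundary.continuous_map hΦ x₀ x₀'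
  have hcΘ : Continuous (VisualBoundary.map hΘ) := VisualBoundary.continuous_map hΘ x₀' x₀
  have hcdp : Continuous dp := continuous_induced_dom
  have hcdp' : Continuous dp' := continuous_induced_dom
  refine (Homeomorph.mk ⟨KappaBoundary.map hΨ o', KappaBoundary.map hΩ o, hl, hr⟩ ?_ ?_).isHomeomorph
  · refine continuous_induced_rng.2 ((hcΦ.comp hcdp).congr fun ξ => (hcomm ξ).symm)
  · refine continuous_induced_rng.2 ((hcΘ.comp hcdp').congr fun ξ => ?_)
    -- The square for the inverse maps needs no separate proof: it is the given square evaluated at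
    -- ∂Ω ξ, with ∂Φ cancelled by ∂Θ.
    have := hcomm (KappaBoundary.map hΩ o ξ)
    rw [hr ξ] at this
    exact (congrArg (VisualBoundary.map hΘ) this).trans (hinv _)

end Transport

section HyperbolicProjection

variable {G : Type*} [Group G] {Y X Y' X' : Type*} [MetricSpace Y] [MetricSpace X]
  [MetricSpace Y'] [MetricSpace X'] [MulAction G Y] [MulAction G X] [MulAction G Y']
  [MulAction G X']

theorem IsGeometricAction.exists_bounded (hY : IsGeometricAction G Y) :
    ∃ B : Set Y, Bornology.IsBounded B ∧ ∀ y : Y, ∃ (g : G) (b : Y), b ∈ B ∧ g • b = y := by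
  obtain ⟨K, hK, hcov⟩ := hY.cocompact
  exact ⟨K, hK.isBounded, hcov⟩

theorem ActionEquivalent.symm [IsIsometricSMul G X'] (h : ActionEquivalent G X X') :
    ActionEquivalent G X' X := by
  obtain ⟨Φ, hΦ, hΦG⟩ := h
  obtain ⟨Θ, hΘ, C, hC, hC'⟩ := hΦ.exists_quasiInverse
  exact ⟨Θ, hΘ, hΦG.quasiInverse hΘ.isCoarselyLipschitz hC hC'⟩

theorem IsQuasiIsometry.isInducedProjection {Φ : X → X'} (hΦ : IsQuasiIsometry Φ)
    (hΦG : IsCoarselyEquivariant G Φ) : IsInducedProjection G Φ :=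
  ⟨hΦ.isCoarselyLipschitz, hΦG⟩

variable [IsGromovHyperbolic X] [IsGromovHyperbolic X']

/-- The definition asks for some induced projection; uniqueness up to bounded distance passes to
every one. -/
theorem IsKappaInjective.isKappaInjectiveMap {κ : SublinearFunction} {o : Y}
    (h : IsHyperbolicProjection G Y X) (hinj : IsKappaInjective G κ o X) {p : Y → X}
    (hp : IsInducedProjection G p) : IsKappaInjectiveMap κ o p := by
  obtain ⟨q, hq, hqinj⟩ := hinj
  have := h.isometric
  obtain ⟨C, hC⟩ := hq.exists_dist_le h.geometric.exists_bounded hp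
  exact IsKappaInjectiveMap.of_dist_le hqinj hC

theorem IsKappaInjective.of_actionEquivalent {κ : SublinearFunction} {o : Y} (o' : Y')
    (h : IsHyperbolicProjection G Y X) (h' : IsHyperbolicProjection G Y' X')
    (hsim : ActionEquivalent G X X') (hinj : IsKappaInjective G κ o X) :
    IsKappaInjective G κ o' X' := by
  obtain ⟨p, hp, hpinj⟩ := hinj
  obtain ⟨Φ, hΦ, hΦG⟩ := hsim
  obtain ⟨Ω, hΩ, C, -, hC⟩ := hΦ.exists_quasiInverse
  obtain ⟨Θ, hΘ, hΘG⟩ := h'.geometric.actionEquivalent h'.geodesic h.geometric h.geodesic o' o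
  exact ⟨fun y => Φ (p (Θ y)),
    (hΦ.isInducedProjection hΦG).comp (hp.comp (hΘ.isInducedProjection hΘG)),
    IsKappaInjectiveMap.comp hpinj o' hΘ (hΦ.preservesGromovProd h.quasiRuling)
      (VisualBoundary.map_leftInverse _ (hΩ.preservesGromovProd h'.quasiRuling) hC).injective⟩

end HyperbolicProjection

theorem lemmaB {G : Type*} [Group G] {Y X Y' X' : Type*}
    [MetricSpace Y] [MetricSpace X] [MetricSpace Y'] [MetricSpace X']
    [IsGromovHyperbolic X] [IsGromovHyperbolic X']
    [MulAction G Y] [MulAction G X] [MulAction G Y'] [MulAction G X']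
    (κ : SublinearFunction) (o : Y) (x₀ : X) (o' : Y') (x₀' : X')
    (h : IsHyperbolicProjection G Y X) (h' : IsHyperbolicProjection G Y' X')
    (hsim : ActionEquivalent G X X') :
    (IsKappaInjective G κ o X ↔ IsKappaInjective G κ o' X') ∧
    ∀ (Ψ : Y → Y') (Φ : X → X') (p : Y → X) (p' : Y' → X'),
      IsQuasiIsometry Ψ → IsCoarselyEquivariant G Ψ →
      IsQuasiIsometry Φ → IsCoarselyEquivariant G Φ →
      IsInducedProjection G p → IsInducedProjection G p' →
      ∃ (dΨ : KappaBoundary κ o → KappaBoundary κ o') (dΦ : VisualBoundary X → VisualBoundary X'),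
        IsKappaBoundaryMap Ψ dΨ ∧ IsVisualBoundaryMap Φ dΦ ∧
        (IsKappaInjective G κ o X →
          ∃ (dp : KappaBoundary κ o → VisualBoundary X)
            (dp' : KappaBoundary κ o' → VisualBoundary X'),
            IsProjectionBoundaryMap p dp ∧ IsProjectionBoundaryMap p' dp' ∧
            Function.Injective dp ∧ Function.Injective dp' ∧
            (∀ ξ : KappaBoundary κ o, dp' (dΨ ξ) = dΦ (dp ξ)) ∧
            @IsHomeomorph _ _ (projectionTopology x₀ dp) (projectionTopology x₀' dp') dΨ) := by
  have := h'.isometric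
  refine ⟨⟨fun hinj => hinj.of_actionEquivalent o' h h' hsim,
    fun hinj => hinj.of_actionEquivalent o h' h hsim.symm⟩,
    fun Ψ Φ p p' hΨ hΨG hΦ hΦG hp hp' => ?_⟩
  have hΦP := hΦ.preservesGromovProd h.quasiRuling
  refine ⟨KappaBoundary.map hΨ o', VisualBoundary.map hΦP,
    KappaBoundary.isKappaBoundaryMap_map hΨ o', VisualBoundary.isVisualBoundaryMap_map hΦP,
    fun hinj => ?_⟩
  obtain ⟨dp, hdp, hdpinj⟩ := (hinj.isKappaInjectiveMap h hp).exists_boundaryMap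
  obtain ⟨dp', hdp', hdpinj'⟩ :=
    ((hinj.of_actionEquivalent o' h h' hsim).isKappaInjectiveMap h' hp').exists_boundaryMap
  obtain ⟨Θ, hΘ, C, -, hC⟩ := hΦ.exists_quasiInverse
  have hΘP := hΘ.preservesGromovProd h'.quasiRuling
  have hcomm : ∀ ξ, dp' (KappaBoundary.map hΨ o' ξ) = VisualBoundary.map hΦP (dp ξ) := by
    -- Φ ∘ p and p' ∘ Ψ are two induced projections Y → X', hence at bounded distance.
    obtain ⟨A, hA⟩ := ((hΦ.isInducedProjection hΦG).comp hp).exists_dist_le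
      h.geometric.exists_bounded (hp'.comp (hΨ.isInducedProjection hΨG))
    intro ξ
    obtain ⟨γ, rfl⟩ := ξ.exists_rep
    have h1 : DefinesPoint γ.1.start (fun t => p' (Ψ (γ.1.toFun t)))
        (VisualBoundary.map hΦP (dp (KappaBoundary.mk γ))) :=
      ((hdp γ).map hΦP).of_dist_le fun t => hA _
    exact (hdp' (γ.map hΨ o')).unique h1
  exact ⟨dp, dp', hdp, hdp', hdpinj, hdpinj', hcomm, KappaBoundary.isHomeomorph_map hΨ hΦP hΘP
    (VisualBoundary.map_leftInverse hΦP hΘP hC) hcomm x₀ x₀'⟩
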